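/- **Setting.** Let $d$ be a fixed integer and consider $Y_i=\mu_i^\star+X_i^T\beta^\star+\epsilon_i$, $1\le i\le n$, where $\beta^\star\in\mathbb R^d$ is fixed; $X_1,X_2,\dots$ are i.i.d. copies of a random vector $X_0$ in $\mathbb R^d$ with mean zero and positive definite covariance matrix $\Sigma_X$; $\epsilon_1,\epsilon_2,\dots$ are i.i.d. copies of $\epsilon_0$ with mean zero and variance $\sigma^2<\infty$; and the sequences $(X_i)$ and $(\epsilon_i)$ are independent. For sequences write $a_n\ll b_n$ for $a_n=o(b_n)$ and $a_n\sim b_n$ for asymptotic equivalence, as $n\to\infty$. Let $\kappa_n,\gamma_n>0$ satisfy $\kappa_n,\gamma_n\ll\sqrt n$, $P(\max_{i\le n}\|X_i\|_2>\kappa_n)\to0$ and $P(\max_{i\le n}|\epsilon_i|>\gamma_n)\to0$. The incidental parameters $\mu_i^\star=\mu_{i,n}^\star$ are deterministic and may depend on $n$. With $s=s_1+s_2\le n$, where $s_1=s_1(n)$, $s_2=s_2(n)\to\infty$ and $s_1,s_2\ll n$: the first $s_1$ are large, $\mu^\star:=\min_{i\le s_1}|\mu_i^\star|\gg\max\{\kappa_n,\gamma_n\}$;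 the next $s_2$ satisfy $0<|\mu_i^\star|\le\gamma_n$; the last $n-s$ are zero. Let $\mu_2^\star=(\mu_{s_1+1}^\star,\dots,\mu_s^\star)$ and $D_n=\|\mu_2^\star\|_2$. The regularization parameter $\lambda=\lambda_n$ satisfies $\kappa_n\ll\lambda$, $\alpha\gamma_n\le\lambda$ for some constant $\alpha>2$, and $\lambda\ll\min\{\mu^\star,\sqrt n\}$. For every $n$ let $(\hat\mu,\hat\beta)$ be, almost surely, a minimizer over $(\mu,\beta)\in\mathbb R^n\times\mathbb R^d$ of $$\sum_{i=1}^n(Y_i-\mu_i-X_i^T\beta)^2+\sum_{i=1}^n2\lambda|\mu_i| ,$$ with $\hat\mu$ measurable. Let $\hat I_0=\{1\le i\le n:\hat\mu_i=0\}$ and let $$\tilde\beta=(X_{\hat I_0}^TX_{\hat I_0})^{-1}X_{\hat I_0}^TY_{\hat I_0}$$ be the two-step estimator, where $X_{\hat I_0}$ has the rows $X_i^T$ and $Y_{\hat I_0}$ the entries $Y_i$, $i\in\hat I_0$ (with the convention $\tilde\beta=0$ if the matrix to be inverted is singular). **Assumption (A).** There is a constant $\delta>0$ with $\mathbb E\|X_0\|_2^{2+\delta}<\infty$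 and $\|\mu_2^\star\|_2/\|\mu_2^\star\|_{2+\delta}\to\infty$, where $\|\mu_2^\star\|_{2+\delta}=\bigl(\sum_{i=s_1+1}^s|\mu_i^\star|^{2+\delta}\bigr)^{1/(2+\delta)}$. **Theorem 3.8.** If either $s_2=o(n/(\kappa_n\gamma_n))$ or assumption (A) holds, then $\tilde\beta\to\beta^\star$ in probability. If $s_2=o(\sqrt n/(\kappa_n\gamma_n))$, then $\sqrt n(\tilde\beta-\beta^\star)\to N(0,\sigma^2\Sigma_X^{-1})$ in distribution. On the other hand, under assumption (A), 1. if $D_n^2/n\to0$, then $\sqrt n(\tilde\beta-\beta^\star)\to N(0,\sigma^2\Sigma_X^{-1})$ in distribution; 2. if $D_n^2/n\to c$ for a constant $c>0$, then $\sqrt n(\tilde\beta-\beta^\star)\to N(0,(c+\sigma^2)\Sigma_X^{-1})$ in distribution; 3. if $D_n^2/n\to\infty$, then every sequence $r_n\sim n/D_n$ satisfies $r_n\ll\sqrt n$ and $r_n(\tilde\beta-\beta^\star)\to N(0,\Sigma_X^{-1})$ in distribution. -/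

import Mathlib

open MeasureTheory ProbabilityTheory Filter Asymptotics
open scoped Topology RealInnerProductSpace

noncomputable section

namespace IncidentalRegression

/-! ### Finite-sample objects: penalized least squares and the two-step estimator -/

/-- The `L₁`-penalized least-squares criterion
`L(m, b) = ∑ᵢ (yᵢ - mᵢ - xᵢᵀ b)² + ∑ᵢ 2 λ |mᵢ|`; only the incidental parameters are penalized. -/
def penalizedLoss {n d : ℕ} (y : Fin n → ℝ) (x : Fin n → EuclideanSpace ℝ (Fin d)) (lam : ℝ)
    (m : Fin n → ℝ) (b : EuclideanSpace ℝ (Fin d)) : ℝ :=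
  ∑ i, (y i - m i - ⟪x i, b⟫) ^ 2 + ∑ i, 2 * lam * |m i|

/-- `(m, b)` is a global minimizer of the penalized criterion over `ℝⁿ × ℝᵈ`. -/
def IsPenalizedEstimator {n d : ℕ} (y : Fin n → ℝ) (x : Fin n → EuclideanSpace ℝ (Fin d))
    (lam : ℝ) (m : Fin n → ℝ) (b : EuclideanSpace ℝ (Fin d)) : Prop :=
  ∀ (m' : Fin n → ℝ) (b' : EuclideanSpace ℝ (Fin d)),
    penalizedLoss y x lam m b ≤ penalizedLoss y x lam m' b'

/-- The matrix whose rows are the covariate vectors `xᵢ`, `i ∈ I`. -/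
def designMatrix {n d : ℕ} (x : Fin n → EuclideanSpace ℝ (Fin d)) (I : Finset (Fin n)) :
    Matrix I (Fin d) ℝ :=
  Matrix.of fun i j => x i j

/-- Ordinary least squares on the observations in `I`: `(X_Iᵀ X_I)⁻¹ X_Iᵀ Y_I`. -/
def olsOn {n d : ℕ} (y : Fin n → ℝ) (x : Fin n → EuclideanSpace ℝ (Fin d))
    (I : Finset (Fin n)) : EuclideanSpace ℝ (Fin d) :=
  WithLp.toLp 2 (Matrix.mulVec ((designMatrix x I).transpose * designMatrix x I)⁻¹
    (Matrix.mulVec (designMatrix x I).transpose fun i : I => y i))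

/-- The set of indices at which `m` vanishes. -/
def zeroSet {n : ℕ} (m : Fin n → ℝ) : Finset (Fin n) :=
  Finset.univ.filter fun i => m i = 0

/-- The two-step estimator: ordinary least squares refitted on the set where `m` vanishes. -/
def twoStep {n d : ℕ} (y : Fin n → ℝ) (x : Fin n → EuclideanSpace ℝ (Fin d))
    (m : Fin n → ℝ) : EuclideanSpace ℝ (Fin d) :=
  olsOn y x (zeroSet m)

/-! ### The model

Observations are numbered from `0`: for sample size `n` they are `i = 0, …, n - 1`, the large
incidental parameters are those with `i < s₁ n`, the bounded nonzero ones those with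
`s₁ n ≤ i < s₁ n + s₂ n`, and the remaining ones vanish. The incidental parameter of observation
`i` at sample size `n` is `mu n i`. -/

/-- The covariance matrix of a random vector. -/
def covMatrix {Ω : Type*} [MeasurableSpace Ω] {d : ℕ} (P : Measure Ω)
    (Z : Ω → EuclideanSpace ℝ (Fin d)) : Matrix (Fin d) (Fin d) ℝ :=
  Matrix.of fun j k => covariance (fun ω => Z ω j) (fun ω => Z ω k) P

/-- The responses `Yᵢ = μᵢ + Xᵢᵀ β + εᵢ`, `i < n`, at sample size `n`. -/
def response {Ω : Type*} {d : ℕ} (X : ℕ → Ω → EuclideanSpace ℝ (Fin d)) (eps : ℕ → Ω → ℝ)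
    (mu : ℕ → ℕ → ℝ) (beta : EuclideanSpace ℝ (Fin d)) (n : ℕ) (ω : Ω) : Fin n → ℝ :=
  fun i => mu n i + ⟪X i ω, beta⟫ + eps i ω

/-- The first `n` covariate vectors. -/
def covariates {Ω : Type*} {d : ℕ} (X : ℕ → Ω → EuclideanSpace ℝ (Fin d)) (n : ℕ) (ω : Ω) :
    Fin n → EuclideanSpace ℝ (Fin d) :=
  fun i => X i ω

/-- The smallest absolute value of the large incidental parameters at sample size `n`
(only relevant when `0 < s₁ n`). -/
def minLarge (mu : ℕ → ℕ → ℝ) (s₁ : ℕ → ℕ) (n : ℕ) : ℝ :=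
  ⨅ i : Fin (s₁ n), |mu n i|

/-- The `ℓ_q` norm `(∑ |μᵢ|^q)^(1/q)` of the vector of bounded incidental parameters. -/
def boundedNorm (q : ℝ) (mu : ℕ → ℕ → ℝ) (s₁ s₂ : ℕ → ℕ) (n : ℕ) : ℝ :=
  (∑ i ∈ Finset.Ico (s₁ n) (s₁ n + s₂ n), |mu n i| ^ q) ^ (1 / q)

/-- `D_n`, the Euclidean norm of the vector of bounded incidental parameters. -/
def boundedEuclideanNorm (mu : ℕ → ℕ → ℝ) (s₁ s₂ : ℕ → ℕ) (n : ℕ) : ℝ :=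
  Real.sqrt (∑ i ∈ Finset.Ico (s₁ n) (s₁ n + s₂ n), mu n i ^ 2)

/-- The stochastic assumptions: i.i.d. centred covariates with positive definite covariance
matrix, independent of i.i.d. centred errors with variance `σ²`, and sequences
`κ, γ ≪ √n` bounding the covariates and the errors with probability tending to one. -/
structure IsStochasticModel {Ω : Type*} [MeasurableSpace Ω] {d : ℕ} (P : Measure Ω)
    (X : ℕ → Ω → EuclideanSpace ℝ (Fin d)) (eps : ℕ → Ω → ℝ) (σ : ℝ) (κ γ : ℕ → ℝ) : Prop where
  measurable_X : ∀ i, Measurable (X i)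
  indep_X : iIndepFun X P
  ident_X : ∀ i, IdentDistrib (X i) (X 0) P P
  memLp_X : MemLp (X 0) 2 P
  mean_X : ∫ ω, X 0 ω ∂P = 0
  posDef_cov : (covMatrix P (X 0)).PosDef
  measurable_eps : ∀ i, Measurable (eps i)
  indep_eps : iIndepFun eps P
  ident_eps : ∀ i, IdentDistrib (eps i) (eps 0) P P
  memLp_eps : MemLp (eps 0) 2 P
  mean_eps : ∫ ω, eps 0 ω ∂P = 0
  var_eps : variance (eps 0) P = σ ^ 2
  indep_X_eps : IndepFun (fun ω i => X i ω) (fun ω i => eps i ω) P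
  κ_pos : ∀ n, 0 < κ n
  γ_pos : ∀ n, 0 < γ n
  κ_small : κ =o[atTop] fun n : ℕ => Real.sqrt n
  γ_small : γ =o[atTop] fun n : ℕ => Real.sqrt n
  max_X : Tendsto (fun n : ℕ => P {ω | ∃ i < n, κ n < ‖X i ω‖}) atTop (𝓝 0)
  max_eps : Tendsto (fun n : ℕ => P {ω | ∃ i < n, γ n < |eps i ω|}) atTop (𝓝 0)

/-- The assumptions on the deterministic incidental parameters: `s₁` large ones, then `s₂` nonzero
ones bounded by `γ`, then zeros, where `s₁, s₂ → ∞` and `s₁, s₂ ≪ n`. -/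
structure IsIncidental (mu : ℕ → ℕ → ℝ) (s₁ s₂ : ℕ → ℕ) (κ γ : ℕ → ℝ) : Prop where
  card_le : ∀ n, s₁ n + s₂ n ≤ n
  s₁_tendsto : Tendsto s₁ atTop atTop
  s₂_tendsto : Tendsto s₂ atTop atTop
  s₁_small : (fun n => (s₁ n : ℝ)) =o[atTop] fun n : ℕ => (n : ℝ)
  s₂_small : (fun n => (s₂ n : ℝ)) =o[atTop] fun n : ℕ => (n : ℝ)
  large : (fun n => max (κ n) (γ n)) =o[atTop] minLarge mu s₁
  bounded_ne_zero : ∀ n i, s₁ n ≤ i → i < s₁ n + s₂ n → mu n i ≠ 0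
  bounded_le : ∀ n i, s₁ n ≤ i → i < s₁ n + s₂ n → |mu n i| ≤ γ n
  eq_zero : ∀ n i, s₁ n + s₂ n ≤ i → i < n → mu n i = 0

/-- The specification of the regularization parameter: `κ ≪ λ`, `α γ ≤ λ` for a constant `α > 2`,
and `λ ≪ min {μ*, √n}`, where `μ*` is the smallest absolute value of the large parameters. -/
structure IsRegularization (lam : ℕ → ℝ) (mu : ℕ → ℕ → ℝ) (s₁ : ℕ → ℕ) (κ γ : ℕ → ℝ) : Prop where
  κ_small : κ =o[atTop] lam
  γ_le : ∃ α : ℝ, 2 < α ∧ ∀ n, α * γ n ≤ lam n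
  lam_small : lam =o[atTop] fun n : ℕ => min (minLarge mu s₁ n) (Real.sqrt n)

/-- Assumption (A): for some `δ > 0`, `E ‖X₀‖^(2+δ) < ∞` and `‖μ₂‖₂ / ‖μ₂‖_{2+δ} → ∞`, where `μ₂`
is the vector of bounded incidental parameters. -/
def AssumptionA {Ω : Type*} [MeasurableSpace Ω] {d : ℕ} (P : Measure Ω)
    (X : ℕ → Ω → EuclideanSpace ℝ (Fin d)) (mu : ℕ → ℕ → ℝ) (s₁ s₂ : ℕ → ℕ) : Prop :=
  ∃ δ : ℝ, 0 < δ ∧ Integrable (fun ω => ‖X 0 ω‖ ^ (2 + δ)) P ∧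
    Tendsto (fun n => boundedEuclideanNorm mu s₁ s₂ n / boundedNorm (2 + δ) mu s₁ s₂ n)
      atTop atTop

/-- Convergence in distribution of a sequence of random vectors to `N(0, S)`. -/
def TendstoNormal {Ω : Type*} [MeasurableSpace Ω] {d : ℕ} (P : Measure Ω) [IsProbabilityMeasure P]
    (Z : ℕ → Ω → EuclideanSpace ℝ (Fin d)) (S : Matrix (Fin d) (Fin d) ℝ) : Prop :=
  TendstoInDistribution Z atTop (id : EuclideanSpace ℝ (Fin d) → EuclideanSpace ℝ (Fin d))
    (fun _ => P) (multivariateGaussian 0 S)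

end IncidentalRegression

end

namespace IncidentalRegression

/-! With probability tending to one the penalized fit discards exactly the observations with large
incidental parameters. The two-step estimator is then least squares on a deterministic index set,
and classical asymptotics apply.

Identification (`zeroSet_eq_indicesFrom`). Optimality in one coordinate gives `m i = 0` exactly when
the residual at `b` is at most `lam` in absolute value. Since `κ` is negligible against `lam`, the
crude bound `‖b - beta‖ ≤ 1` already suffices: it moves residuals by at most `κ`, too little to
confuse parameters above `lam + γ + κ` with those below `γ`. The bound comes from convexity
(`norm_sub_le_one`): on the unit sphere around `beta` the criterion minus its value at `beta` is at
least a quadratic form of order `n`, minus two linear terms. These are the score of the retained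
observations and `lam` times a signed sum of the discarded covariates, both `o(n)` in mean square.

Linearization (`highProb_twoStep_linearization`). The Gram matrix of the retained rows divided by
`n` tends to the covariance matrix by the strong law, so the error is the inverse covariance applied
to `score / n`, up to a relative error tending to zero. The score is a sum of independent centred
vectors `(μᵢ + εᵢ) Xᵢ`, with covariance `D_n² + (n - s₁) σ²` times that of `X 0`. Consistency
follows from `D_n² ≤ s₂ γ² = o(n²)`.

Normality. `tendsto_integral_exp_sum` is a Lindeberg theorem for such sums, requiring the scaled
shifts to be uniformly negligible. At rate `√n` this is `γ = o(√n)`; at rate `n / D_n` the shifts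
are bounded by the `ℓ_{2+δ}` norm, which assumption (A) makes negligible against `D_n`. The limits
of `D_n² / n` decide which variance contribution survives. -/

lemma penalizedLoss_eq_sum {n d : ℕ} (y : Fin n → ℝ) (x : Fin n → EuclideanSpace ℝ (Fin d))
    (lam : ℝ) (m : Fin n → ℝ) (b : EuclideanSpace ℝ (Fin d)) :
    penalizedLoss y x lam m b = ∑ i, ((y i - m i - ⟪x i, b⟫) ^ 2 + 2 * lam * |m i|) := by
  rw [penalizedLoss, Finset.sum_add_distrib]

/-! ### Deterministic analysis of the penalized criterion. -/

lemma IsPenalizedEstimator.coordinate_le {n d : ℕ} {y : Fin n → ℝ}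
    {x : Fin n → EuclideanSpace ℝ (Fin d)} {lam : ℝ} {m : Fin n → ℝ}
    {b : EuclideanSpace ℝ (Fin d)} (h : IsPenalizedEstimator y x lam m b) (i : Fin n) (t : ℝ) :
    (y i - m i - ⟪x i, b⟫) ^ 2 + 2 * lam * |m i| ≤
      (y i - t - ⟪x i, b⟫) ^ 2 + 2 * lam * |t| := by
  -- With `b` frozen the criterion separates over coordinates, so a joint minimizer solves every
  -- scalar problem.
  have h1 := h (Function.update m i t) b
  rw [penalizedLoss_eq_sum, penalizedLoss_eq_sum,
    ← Finset.add_sum_erase _ _ (Finset.mem_univ i),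
    ← Finset.add_sum_erase (a := i) _ (fun j => (y j - Function.update m i t j - ⟪x j, b⟫) ^ 2 +
      2 * lam * |Function.update m i t j|) (Finset.mem_univ i)] at h1
  have h2 : ∑ j ∈ Finset.univ.erase i, ((y j - Function.update m i t j - ⟪x j, b⟫) ^ 2 +
      2 * lam * |Function.update m i t j|) =
      ∑ j ∈ Finset.univ.erase i, ((y j - m j - ⟪x j, b⟫) ^ 2 + 2 * lam * |m j|) := by
    refine Finset.sum_congr rfl fun j hj => ?_
    rw [Function.update_of_ne (Finset.ne_of_mem_erase hj)]
  rw [h2, Function.update_self] at h1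
  linarith

/-- The penalized estimate of an incidental parameter vanishes exactly when the residual does not
exceed the regularization parameter. -/
lemma IsPenalizedEstimator.eq_zero_iff {n d : ℕ} {y : Fin n → ℝ}
    {x : Fin n → EuclideanSpace ℝ (Fin d)} {lam : ℝ} {m : Fin n → ℝ}
    {b : EuclideanSpace ℝ (Fin d)} (h : IsPenalizedEstimator y x lam m b)
    (i : Fin n) : m i = 0 ↔ |y i - ⟪x i, b⟫| ≤ lam := by
  constructor
  · intro hm
    by_contra! hlt
    obtain ⟨u, hu⟩ : ∃ u, u = y i - ⟪x i, b⟫ := ⟨_, rfl⟩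
    rw [← hu] at hlt
    rcases le_or_gt 0 u with h0 | h0
    · have h1 := h.coordinate_le i (u - lam)
      rw [abs_of_nonneg h0] at hlt
      rw [hm, abs_zero, abs_of_nonneg (by linarith)] at h1
      nlinarith
    · have h1 := h.coordinate_le i (u + lam)
      rw [abs_of_neg h0] at hlt
      rw [hm, abs_zero, abs_of_nonpos (by linarith)] at h1
      nlinarith
  · intro hle
    have h1 := h.coordinate_le i 0
    have h2 : (y i - ⟪x i, b⟫) * m i ≤ lam * |m i| :=
      (le_abs_self _).trans (by rw [abs_mul]; gcongr)
    rw [abs_zero] at h1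
    have : m i ^ 2 ≤ 0 := by nlinarith
    exact pow_eq_zero_iff (two_ne_zero) |>.1 (le_antisymm this (sq_nonneg _))

/-- A convexity argument localizing the penalized estimator: if on the unit sphere around `β` the
criterion exceeds its value at `β`, then the estimator lies in the unit ball. -/
lemma IsPenalizedEstimator.norm_sub_le_one {n d : ℕ} {y : Fin n → ℝ}
    {x : Fin n → EuclideanSpace ℝ (Fin d)} {lam : ℝ} {m : Fin n → ℝ}
    {b : EuclideanSpace ℝ (Fin d)} (h : IsPenalizedEstimator y x lam m b) (hlam : 0 ≤ lam)
    (β : EuclideanSpace ℝ (Fin d)) (J : Finset (Fin n)) (sg : Fin n → ℝ)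
    (hsg : ∀ i ∈ J, |sg i| = 1) (hr : ∀ i ∈ J, lam ≤ sg i * (y i - ⟪x i, β⟫))
    (hsmall : ∀ v : EuclideanSpace ℝ (Fin d), ‖v‖ = 1 → ∀ i ∉ J,
      |y i - ⟪x i, β⟫ - ⟪x i, v⟫| ≤ lam)
    (hpos : ∀ v : EuclideanSpace ℝ (Fin d), ‖v‖ = 1 →
      2 * ∑ i ∈ Jᶜ, (y i - ⟪x i, β⟫) * ⟪x i, v⟫ + 2 * lam * ∑ i ∈ J, sg i * ⟪x i, v⟫ <
        ∑ i ∈ Jᶜ, ⟪x i, v⟫ ^ 2) :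
    ‖b - β‖ ≤ 1 := by
  by_contra! hlt
  -- This `t` places `β + v` where the segment from `β` to `b` crosses the unit sphere around `β`.
  obtain ⟨t, ht⟩ : ∃ t, t = ‖b - β‖⁻¹ := ⟨_, rfl⟩
  have ht0 : 0 ≤ t := by rw [ht]; positivity
  have ht1 : t ≤ 1 := by rw [ht]; exact inv_le_one_of_one_le₀ hlt.le
  obtain ⟨v, hv⟩ : ∃ v, v = t • (b - β) := ⟨_, rfl⟩
  have hv1 : ‖v‖ = 1 := by
    rw [hv, norm_smul, Real.norm_of_nonneg ht0, ht, inv_mul_cancel₀ (by linarith)]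
  -- The residuals at `β` are soft-thresholded on `J` and replaced by zero elsewhere. Then `(m', β +
  -- v)` lies on the segment from `(m₀, β)` to the minimizer, so by convexity its loss does not
  -- exceed that of `(m₀, β)`.
  set m₀ : Fin n → ℝ := fun i => if i ∈ J then y i - ⟪x i, β⟫ - lam * sg i else 0 with hm₀
  set m' : Fin n → ℝ := fun i => (1 - t) * m₀ i + t * m i with hm'
  have hconv : penalizedLoss y x lam m' (β + v) ≤
      (1 - t) * penalizedLoss y x lam m₀ β + t * penalizedLoss y x lam m b := by
    simp only [penalizedLoss_eq_sum, Finset.mul_sum, ← Finset.sum_add_distrib]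
    refine Finset.sum_le_sum fun i _ => ?_
    have h1 : |m' i| ≤ (1 - t) * |m₀ i| + t * |m i| := by
      refine (abs_add_le _ _).trans ?_
      rw [abs_mul, abs_mul, abs_of_nonneg ht0, abs_of_nonneg (sub_nonneg.2 ht1)]
    have h2 : y i - m' i - ⟪x i, β + v⟫ =
        (1 - t) * (y i - m₀ i - ⟪x i, β⟫) + t * (y i - m i - ⟪x i, b⟫) := by
      rw [inner_add_right, hv, inner_smul_right, inner_sub_right]
      simp only [hm']
      ring
    rw [h2]
    have h3 := mul_le_mul_of_nonneg_left h1 hlam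
    nlinarith [mul_nonneg (mul_nonneg ht0 (sub_nonneg.2 ht1))
      (sq_nonneg ((y i - m₀ i - ⟪x i, β⟫) - (y i - m i - ⟪x i, b⟫)))]
  have hopt := h m₀ β
  have hle : penalizedLoss y x lam m' (β + v) ≤ penalizedLoss y x lam m₀ β := by nlinarith
  -- Minimizing out a coordinate of `m` leaves a Huber function of the residual. On `J` it is
  -- bounded below by its linear branch of slope `2 * lam * sg i`, which is attained at `β`; off `J`
  -- the residuals stay on the quadratic branch.
  have hlow : ∑ i, (if i ∈ J then -(2 * lam * (sg i * ⟪x i, v⟫)) else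
      ⟪x i, v⟫ ^ 2 - 2 * ((y i - ⟪x i, β⟫) * ⟪x i, v⟫)) ≤
      penalizedLoss y x lam m' (β + v) - penalizedLoss y x lam m₀ β := by
    simp only [penalizedLoss_eq_sum, ← Finset.sum_sub_distrib]
    refine Finset.sum_le_sum fun i _ => ?_
    rw [inner_add_right]
    have hs := hsmall v hv1 i
    generalize ⟪x i, v⟫ = w at *
    generalize m' i = a at *
    by_cases hi : i ∈ J
    · simp only [hi, if_true, hm₀]
      have hsi := hsg i hi
      have hri := hr i hi
      obtain ⟨r, hr'⟩ : ∃ r, r = y i - ⟪x i, β⟫ := ⟨_, rfl⟩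
      rw [← hr'] at hri ⊢
      have e1 : y i - a - (⟪x i, β⟫ + w) = r - w - a := by rw [hr']; ring
      have e2 : y i - (r - lam * sg i) - ⟪x i, β⟫ = lam * sg i := by rw [hr']; ring
      have hsq : sg i * sg i = 1 := by rw [← abs_mul_abs_self, hsi, one_mul]
      have e3 : |r - lam * sg i| = sg i * r - lam := by
        have : r - lam * sg i = sg i * (sg i * r - lam) := by linear_combination (-r) * hsq
        rw [this, abs_mul, hsi, one_mul, abs_of_nonneg (by linarith)]
      rw [e1, e2, e3]
      have h1 : sg i * (r - w) ≤ |a| + |r - w - a| := by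
        calc sg i * (r - w) ≤ |sg i * (r - w)| := le_abs_self _
          _ = |a + (r - w - a)| := by rw [abs_mul, hsi, one_mul]; congr 1; ring
          _ ≤ _ := abs_add_le _ _
      have h2 : (lam * sg i) ^ 2 = lam ^ 2 := by rw [mul_pow, sq (sg i), hsq, mul_one]
      rw [h2, ← sq_abs (r - w - a)]
      nlinarith [sq_nonneg (|r - w - a| - lam), mul_le_mul_of_nonneg_left h1 hlam]
    · simp only [hi, if_false, hm₀]
      have h1 : (y i - ⟪x i, β⟫ - w) * a ≤ lam * |a| :=
        (le_abs_self _).trans (by rw [abs_mul]; gcongr; exact hs hi)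
      rw [abs_zero]
      nlinarith [sq_nonneg a]
  have hsplit : ∑ i, (if i ∈ J then -(2 * lam * (sg i * ⟪x i, v⟫)) else
      ⟪x i, v⟫ ^ 2 - 2 * ((y i - ⟪x i, β⟫) * ⟪x i, v⟫)) =
      ∑ i ∈ Jᶜ, ⟪x i, v⟫ ^ 2 - (2 * ∑ i ∈ Jᶜ, (y i - ⟪x i, β⟫) * ⟪x i, v⟫ +
        2 * lam * ∑ i ∈ J, sg i * ⟪x i, v⟫) := by
    rw [← Finset.sum_add_sum_compl J,
      Finset.sum_congr rfl fun i hi => if_pos hi,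
      Finset.sum_congr (s₁ := Jᶜ) rfl fun i hi => if_neg (Finset.mem_compl.1 hi),
      Finset.sum_neg_distrib, Finset.sum_sub_distrib, Finset.mul_sum, Finset.mul_sum]
    ring
  have := hpos v hv1
  linarith

/-! ### Least squares on a fixed set of observations. -/

lemma designMatrix_transpose_mulVec {n d : ℕ} (x : Fin n → EuclideanSpace ℝ (Fin d))
    (I : Finset (Fin n)) (w : I → ℝ) :
    WithLp.toLp 2 (Matrix.mulVec (designMatrix x I).transpose w) = ∑ i : I, w i • x i := by
  ext j
  simp [Matrix.mulVec, dotProduct, designMatrix, mul_comm]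

lemma toEuclideanCLM_gram_apply {n d : ℕ} (x : Fin n → EuclideanSpace ℝ (Fin d))
    (I : Finset (Fin n)) (v : EuclideanSpace ℝ (Fin d)) :
    Matrix.toEuclideanCLM (𝕜 := ℝ) ((designMatrix x I).transpose * designMatrix x I) v =
      ∑ i ∈ I, ⟪x i, v⟫ • x i := by
  have h1 : Matrix.toEuclideanCLM (𝕜 := ℝ) ((designMatrix x I).transpose * designMatrix x I) v =
      WithLp.toLp 2 (Matrix.mulVec (designMatrix x I).transpose
        (Matrix.mulVec (designMatrix x I) v.ofLp)) := by
    rw [Matrix.mulVec_mulVec]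
    exact Matrix.toEuclideanCLM_toLp _ v.ofLp
  rw [h1, designMatrix_transpose_mulVec, ← Finset.sum_coe_sort I]
  refine Finset.sum_congr rfl fun i _ => ?_
  congr 1
  simp [Matrix.mulVec, dotProduct, designMatrix, PiLp.inner_apply, mul_comm]

/-- The normal equations. -/
lemma toEuclideanCLM_gram_olsOn {n d : ℕ} (y : Fin n → ℝ) (x : Fin n → EuclideanSpace ℝ (Fin d))
    (I : Finset (Fin n))
    (hdet : IsUnit ((designMatrix x I).transpose * designMatrix x I).det) :
    Matrix.toEuclideanCLM (𝕜 := ℝ) ((designMatrix x I).transpose * designMatrix x I)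
      (olsOn y x I) = ∑ i ∈ I, y i • x i := by
  rw [olsOn, Matrix.toEuclideanCLM_toLp, Matrix.mulVec_mulVec, Matrix.mul_nonsing_inv _ hdet,
    Matrix.one_mulVec, designMatrix_transpose_mulVec, Finset.sum_coe_sort I fun i => y i • x i]

/-- If the normalized Gram matrix is close to an invertible `S`, the error of ordinary least squares
is close to `S⁻¹` applied to the normalized score. -/
lemma norm_olsOn_sub_sub_le {n d : ℕ} {y r : Fin n → ℝ} {x : Fin n → EuclideanSpace ℝ (Fin d)}
    {I : Finset (Fin n)} {β : EuclideanSpace ℝ (Fin d)} (hy : ∀ i ∈ I, y i = r i + ⟪x i, β⟫)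
    {S Sinv : EuclideanSpace ℝ (Fin d) →L[ℝ] EuclideanSpace ℝ (Fin d)} (hS : ∀ v, Sinv (S v) = v)
    {c η : ℝ} (hη : ‖Sinv‖ * η ≤ 1 / 2)
    (hclose : ‖c • Matrix.toEuclideanCLM (𝕜 := ℝ)
      ((designMatrix x I).transpose * designMatrix x I) - S‖ ≤ η) :
    ‖(olsOn y x I - β) - Sinv (c • ∑ i ∈ I, r i • x i)‖ ≤
      2 * (‖Sinv‖ * η) * ‖Sinv (c • ∑ i ∈ I, r i • x i)‖ := by
  set G := Matrix.toEuclideanCLM (𝕜 := ℝ) ((designMatrix x I).transpose * designMatrix x I) with hG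
  -- `Sinv ∘ (c • G)` differs from the identity by an operator of norm at most `1 / 2`. Hence `G` is
  -- injective and the normal equations are solvable.
  have key : ∀ v, ‖v - Sinv (c • G v)‖ ≤ ‖Sinv‖ * η * ‖v‖ := by
    intro v
    have : v - Sinv (c • G v) = -Sinv ((c • G - S) v) := by
      simp [hS]
    rw [this, norm_neg, mul_assoc]
    refine (Sinv.le_opNorm _).trans (mul_le_mul_of_nonneg_left ?_ (norm_nonneg _))
    exact ((c • G - S).le_opNorm v).trans (mul_le_mul_of_nonneg_right hclose (norm_nonneg _))
  have hinj : ∀ v, G v = 0 → v = 0 := by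
    intro v hv
    have h1 := key v
    rw [hv, smul_zero, map_zero, sub_zero] at h1
    have := norm_nonneg v
    exact norm_eq_zero.1 (by nlinarith)
  have hdet : IsUnit ((designMatrix x I).transpose * designMatrix x I).det := by
    rw [isUnit_iff_ne_zero]
    intro h0
    obtain ⟨v, hv0, hv⟩ := Matrix.exists_mulVec_eq_zero_iff.2 h0
    refine hv0 ?_
    have := hinj (WithLp.toLp 2 v) (by rw [hG, Matrix.toEuclideanCLM_toLp, hv]; rfl)
    simpa using this
  have hΔ : G (olsOn y x I - β) = ∑ i ∈ I, r i • x i := by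
    rw [map_sub, hG, toEuclideanCLM_gram_olsOn _ _ _ hdet, toEuclideanCLM_gram_apply,
      ← Finset.sum_sub_distrib]
    refine Finset.sum_congr rfl fun i hi => ?_
    rw [hy i hi, ← sub_smul]
    congr 1
    ring
  have h1 := key (olsOn y x I - β)
  rw [hΔ] at h1
  generalize olsOn y x I - β = Δ at *
  generalize Sinv (c • ∑ i ∈ I, r i • x i) = Z at *
  have h2 : ‖Δ‖ ≤ ‖Δ - Z‖ + ‖Z‖ := by
    simpa using norm_add_le (Δ - Z) Z
  have h3 := norm_nonneg Δ
  have h4 : 0 ≤ ‖Δ - Z‖ := norm_nonneg _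
  -- From `‖Δ - Z‖ ≤ ‖Δ‖ / 2`; substituting it back into the sharper bound `h1` turns an error
  -- relative to `Δ` into one relative to `Z`, at the cost of the factor `2`.
  have h5 : ‖Δ‖ ≤ 2 * ‖Z‖ := by nlinarith
  have h6 : 0 ≤ η := (norm_nonneg _).trans hclose
  have h7 : 0 ≤ ‖Sinv‖ * η := by positivity
  nlinarith

/-! ### Measurability of the two-step estimator. -/

/-- The least squares estimator is a measurable function of measurable data. -/
lemma measurable_olsOn {Ω : Type*} [MeasurableSpace Ω] {n d : ℕ} {y : Ω → Fin n → ℝ}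
    {x : Ω → Fin n → EuclideanSpace ℝ (Fin d)} (hy : Measurable y) (hx : Measurable x)
    (I : Finset (Fin n)) : Measurable fun ω => olsOn (y ω) (x ω) I := by
  have hX : ∀ i j, Measurable fun ω => designMatrix (x ω) I i j := fun i j => by
    simp only [designMatrix, Matrix.of_apply]
    fun_prop
  have hG : Measurable fun ω (j k : Fin d) =>
      ((designMatrix (x ω) I).transpose * designMatrix (x ω) I) j k := by
    refine measurable_pi_iff.2 fun j => measurable_pi_iff.2 fun k => ?_
    simp only [Matrix.mul_apply, Matrix.transpose_apply]
    exact Finset.measurable_sum _ fun i _ => (hX i j).mul (hX i k)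
  have hinv : ∀ j k, Measurable fun ω =>
      ((designMatrix (x ω) I).transpose * designMatrix (x ω) I)⁻¹ j k := by
    intro j k
    have h1 : Measurable fun M : Fin d → Fin d → ℝ => (Matrix.of M)⁻¹ j k := by
      have hc : Continuous fun M : Fin d → Fin d → ℝ => Matrix.of M := continuous_id
      -- The inverse is the reciprocal determinant times the adjugate. The reciprocal with value `0`
      -- at `0` is discontinuous but measurable, which covers singular matrices.
      simp only [Matrix.inv_def, Matrix.smul_apply, Ring.inverse_eq_inv', smul_eq_mul]
      exact hc.matrix_det.measurable.inv.mul (hc.matrix_adjugate.matrix_elem j k).measurable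
    exact h1.comp hG
  refine (WithLp.measurable_toLp 2 _).comp (measurable_pi_iff.2 fun j => ?_)
  simp only [Matrix.mulVec, dotProduct, Matrix.transpose_apply]
  refine Finset.measurable_sum _ fun k _ => (hinv j k).mul (Finset.measurable_sum _ fun i _ => ?_)
  exact (hX i k).mul (by fun_prop)

/-- The selected set takes finitely many values, each on a measurable event, and on each event the
estimator is least squares on a fixed set. -/
lemma measurable_twoStep {Ω : Type*} [MeasurableSpace Ω] {n d : ℕ} {y m : Ω → Fin n → ℝ}
    {x : Ω → Fin n → EuclideanSpace ℝ (Fin d)} (hy : Measurable y) (hx : Measurable x)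
    (hm : Measurable m) : Measurable fun ω => twoStep (y ω) (x ω) (m ω) := by
  have hset : ∀ I : Finset (Fin n), MeasurableSet {ω | zeroSet (m ω) = I} := by
    intro I
    have : {ω | zeroSet (m ω) = I} = ⋂ i, {ω | m ω i = 0 ↔ i ∈ I} := by
      ext ω
      simp [zeroSet, Finset.ext_iff]
    rw [this]
    refine MeasurableSet.iInter fun i => ?_
    have h1 : MeasurableSet {ω | m ω i = 0} :=
      (measurable_pi_iff.1 hm i) (measurableSet_singleton 0)
    by_cases hi : i ∈ I
    · simpa only [hi, iff_true] using h1
    · simp only [hi, iff_false]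
      exact h1.compl
  have hsum : (fun ω => twoStep (y ω) (x ω) (m ω)) = fun ω => ∑ I : Finset (Fin n),
      {ω | zeroSet (m ω) = I}.indicator (fun ω => olsOn (y ω) (x ω) I) ω := by
    funext ω
    rw [Finset.sum_eq_single (zeroSet (m ω))]
    · rw [Set.indicator_of_mem (by simp), twoStep]
    · intro I _ hI
      exact Set.indicator_of_notMem (fun h => hI h.symm) _
    · simp
  rw [hsum]
  exact Finset.measurable_sum _ fun I _ => (measurable_olsOn hy hx I).indicator (hset I)

/-! ### Independent pairs and second moments of weighted sums. -/

/-- Pairing two independent sequences of independent random variables gives independent pairs. -/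
lemma iIndepFun_prodMk {Ω A B ι : Type*} [MeasurableSpace Ω] [MeasurableSpace A]
    [MeasurableSpace B] {P : Measure Ω} {f : ι → Ω → A} {g : ι → Ω → B}
    (hf : ∀ i, Measurable (f i)) (hg : ∀ i, Measurable (g i)) (hfi : iIndepFun f P)
    (hgi : iIndepFun g P) (hfg : IndepFun (fun ω i => f i ω) (fun ω i => g i ω) P) :
    iIndepFun (fun i ω => (f i ω, g i ω)) P := by
  -- Measurable rectangles form a π-system generating the product σ-algebra, so factorization has to
  -- be checked on them only.
  set R : Set (Set (A × B)) :=
    Set.image2 (fun s t => s ×ˢ t) {s | MeasurableSet s} {t | MeasurableSet t} with hR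
  refine iIndepSets.iIndep (fun i => ((hf i).prodMk (hg i)).comap_le)
    (fun i => {s | ∃ t ∈ R, (fun ω => (f i ω, g i ω)) ⁻¹' t = s})
    (fun i => isPiSystem_prod.comap _) (fun i => ?_) ?_
  · rw [hR, ← generateFrom_prod, MeasurableSpace.comap_generateFrom]
    rfl
  · rw [iIndepSets_iff]
    intro s F hF
    choose! r hrR hr using hF
    choose! a ha b hb hab using hrR
    have hF' : ∀ i ∈ s, F i = f i ⁻¹' a i ∩ g i ⁻¹' b i := by
      intro i hi
      rw [← hr i hi, ← hab i hi, Set.mk_preimage_prod]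
    have h1 : ⋂ i ∈ s, F i = (⋂ i ∈ s, f i ⁻¹' a i) ∩ ⋂ i ∈ s, g i ⁻¹' b i := by
      rw [Set.iInter₂_congr hF']
      ext
      simp [forall_and]
    have h2 : ⋂ i ∈ s, f i ⁻¹' a i = (fun ω i => f i ω) ⁻¹' ⋂ i ∈ s, (fun x => x i) ⁻¹' a i := by
      ext; simp
    have h3 : ⋂ i ∈ s, g i ⁻¹' b i = (fun ω i => g i ω) ⁻¹' ⋂ i ∈ s, (fun x => x i) ⁻¹' b i := by
      ext; simp
    rw [h1, h2, h3, hfg.measure_inter_preimage_eq_mul _ _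
      (Finset.measurableSet_biInter _ fun i hi => measurable_pi_apply i (ha i hi))
      (Finset.measurableSet_biInter _ fun i hi => measurable_pi_apply i (hb i hi)), ← h2, ← h3,
      hfi.measure_inter_preimage_eq_mul s ha, hgi.measure_inter_preimage_eq_mul s hb,
      ← Finset.prod_mul_distrib]
    refine Finset.prod_congr rfl fun i hi => ?_
    rw [hF' i hi]
    have hi' : IndepFun (f i) (g i) P :=
      hfg.comp (measurable_pi_apply i) (measurable_pi_apply i)
    exact (hi'.measure_inter_preimage_eq_mul _ _ (ha i hi) (hb i hi)).symm

/-- Independent copies of a pair of independent, centred, square integrable random variables. -/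
structure IsCenteredPair {Ω : Type*} [MeasurableSpace Ω] (P : Measure Ω) (U e : ℕ → Ω → ℝ) :
    Prop where
  measurable_fst : ∀ i, Measurable (U i)
  measurable_snd : ∀ i, Measurable (e i)
  indep : iIndepFun (fun i ω => (U i ω, e i ω)) P
  ident : ∀ i, IdentDistrib (fun ω => (U i ω, e i ω)) (fun ω => (U 0 ω, e 0 ω)) P P
  indepFun : IndepFun (U 0) (e 0) P
  memLp_fst : MemLp (U 0) 2 P
  memLp_snd : MemLp (e 0) 2 P
  mean_fst : ∫ ω, U 0 ω ∂P = 0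
  mean_snd : ∫ ω, e 0 ω ∂P = 0

namespace IsCenteredPair

variable {Ω : Type*} [MeasurableSpace Ω] {P : Measure Ω} {U e : ℕ → Ω → ℝ}

/-- The factor `τ` lets one family of terms serve two sums: `τ = 1` for the score, `τ = 0` for
signed sums of covariates. -/
lemma measurable_term (h : IsCenteredPair P U e) (i : ℕ) (c τ : ℝ) :
    Measurable fun ω => U i ω * (c + τ * e i ω) :=
  (h.measurable_fst i).mul (measurable_const.add ((h.measurable_snd i).const_mul τ))

lemma identDistrib_term (h : IsCenteredPair P U e) (i : ℕ) (c τ : ℝ) :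
    IdentDistrib (fun ω => U i ω * (c + τ * e i ω)) (fun ω => U 0 ω * (c + τ * e 0 ω)) P P :=
  (h.ident i).comp (u := fun p : ℝ × ℝ => p.1 * (c + τ * p.2)) (by fun_prop)

lemma memLp_affine [IsProbabilityMeasure P] (h : IsCenteredPair P U e) (c τ : ℝ) :
    MemLp (fun ω => c + τ * e 0 ω) 2 P :=
  (memLp_const c).add (h.memLp_snd.const_mul τ)

lemma indepFun_affine (h : IsCenteredPair P U e) (c τ : ℝ) :
    IndepFun (U 0) (fun ω => c + τ * e 0 ω) P :=
  h.indepFun.comp (φ := id) (ψ := fun x => c + τ * x) measurable_id (by fun_prop)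

/-- A product of square integrable variables need not be square integrable; the independence of `U
0` and `e 0` makes it so. -/
lemma memLp_term [IsProbabilityMeasure P] (h : IsCenteredPair P U e) (i : ℕ) (c τ : ℝ) :
    MemLp (fun ω => U i ω * (c + τ * e i ω)) 2 P := by
  rw [(h.identDistrib_term i c τ).memLp_iff,
    memLp_two_iff_integrable_sq (h.measurable_term 0 c τ).aestronglyMeasurable]
  have h1 : IndepFun (fun ω => U 0 ω ^ 2) (fun ω => (c + τ * e 0 ω) ^ 2) P :=
    (h.indepFun_affine c τ).comp (φ := fun x => x ^ 2) (ψ := fun x => x ^ 2)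
      (by fun_prop) (by fun_prop)
  refine (h1.integrable_mul h.memLp_fst.integrable_sq (h.memLp_affine c τ).integrable_sq).congr
    (ae_of_all _ fun ω => ?_)
  simp only [Pi.mul_apply]
  ring

lemma integral_term [IsProbabilityMeasure P] (h : IsCenteredPair P U e) (i : ℕ) (c τ : ℝ) :
    ∫ ω, U i ω * (c + τ * e i ω) ∂P = 0 := by
  rw [(h.identDistrib_term i c τ).integral_eq,
    (h.indepFun_affine c τ).integral_fun_mul_eq_mul_integral
      h.memLp_fst.aestronglyMeasurable (h.memLp_affine c τ).aestronglyMeasurable,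
    h.mean_fst, zero_mul]

lemma integral_affine_sq [IsProbabilityMeasure P] (h : IsCenteredPair P U e) (c τ : ℝ) :
    ∫ ω, (c + τ * e 0 ω) ^ 2 ∂P = c ^ 2 + τ ^ 2 * ∫ ω, e 0 ω ^ 2 ∂P := by
  have hi : Integrable (e 0) P := h.memLp_snd.integrable (by norm_num)
  have h1 : ∀ ω, (c + τ * e 0 ω) ^ 2 = c ^ 2 + (2 * c * τ * e 0 ω + τ ^ 2 * e 0 ω ^ 2) :=
    fun ω => by ring
  simp_rw [h1]
  have h2 : Integrable (fun ω => 2 * c * τ * e 0 ω) P := hi.const_mul _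
  have h3 : Integrable (fun ω => τ ^ 2 * e 0 ω ^ 2) P := h.memLp_snd.integrable_sq.const_mul _
  have h4 : Integrable (fun ω => 2 * c * τ * e 0 ω + τ ^ 2 * e 0 ω ^ 2) P := h2.add h3
  rw [integral_add (integrable_const _) h4, integral_add h2 h3, integral_const_mul,
    integral_const_mul, h.mean_snd]
  simp

lemma integral_term_sq [IsProbabilityMeasure P] (h : IsCenteredPair P U e) (i : ℕ) (c τ : ℝ) :
    ∫ ω, (U i ω * (c + τ * e i ω)) ^ 2 ∂P =
      (c ^ 2 + τ ^ 2 * ∫ ω, e 0 ω ^ 2 ∂P) * ∫ ω, U 0 ω ^ 2 ∂P := by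
  have h1 : IndepFun (fun ω => U 0 ω ^ 2) (fun ω => (c + τ * e 0 ω) ^ 2) P :=
    (h.indepFun_affine c τ).comp (φ := fun x => x ^ 2) (ψ := fun x => x ^ 2)
      (by fun_prop) (by fun_prop)
  have h2 := ((h.identDistrib_term i c τ).sq).integral_eq
  rw [h2]
  simp_rw [mul_pow]
  rw [h1.integral_fun_mul_eq_mul_integral h.memLp_fst.integrable_sq.aestronglyMeasurable
    (h.memLp_affine c τ).integrable_sq.aestronglyMeasurable, h.integral_affine_sq, mul_comm]

lemma iIndepFun_term (h : IsCenteredPair P U e) (c : ℕ → ℝ) (τ : ℝ) :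
    iIndepFun (fun i ω => U i ω * (c i + τ * e i ω)) P :=
  h.indep.comp (fun i (p : ℝ × ℝ) => p.1 * (c i + τ * p.2)) fun i => by fun_prop

lemma memLp_sum [IsProbabilityMeasure P] (h : IsCenteredPair P U e) (J : Finset ℕ)
    (c : ℕ → ℝ) (τ : ℝ) :
    MemLp (fun ω => ∑ i ∈ J, U i ω * (c i + τ * e i ω)) 2 P :=
  memLp_finsetSum J fun i _ => h.memLp_term i (c i) τ

/-- The second moment of a weighted sum. -/
lemma integral_sum_sq [IsProbabilityMeasure P] (h : IsCenteredPair P U e) (J : Finset ℕ)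
    (c : ℕ → ℝ) (τ : ℝ) :
    ∫ ω, (∑ i ∈ J, U i ω * (c i + τ * e i ω)) ^ 2 ∂P =
      (∑ i ∈ J, (c i ^ 2 + τ ^ 2 * ∫ ω, e 0 ω ^ 2 ∂P)) * ∫ ω, U 0 ω ^ 2 ∂P := by
  have hmean : ∫ ω, ∑ i ∈ J, U i ω * (c i + τ * e i ω) ∂P = 0 := by
    rw [integral_finsetSum _ fun i _ => (h.memLp_term i (c i) τ).integrable (by norm_num)]
    exact Finset.sum_eq_zero fun i _ => h.integral_term i (c i) τ
  have hvar := IndepFun.variance_sum (μ := P) (s := J)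
    (X := fun i ω => U i ω * (c i + τ * e i ω)) (fun i _ => h.memLp_term i (c i) τ)
    fun i _ j _ hij => (h.iIndepFun_term c τ).indepFun hij
  have hfun : (∑ i ∈ J, fun ω => U i ω * (c i + τ * e i ω)) =
      fun ω => ∑ i ∈ J, U i ω * (c i + τ * e i ω) := by
    ext; simp
  rw [hfun, variance_of_integral_eq_zero (h.memLp_sum J c τ).aemeasurable hmean] at hvar
  rw [hvar, Finset.sum_mul]
  refine Finset.sum_congr rfl fun i _ => ?_
  rw [variance_of_integral_eq_zero (h.measurable_term i (c i) τ).aemeasurable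
    (h.integral_term i (c i) τ), h.integral_term_sq]

end IsCenteredPair

/-! ### A central limit theorem for weighted sums -/

/-- Factors are exchanged one at a time; those of modulus at most one do not amplify the error. -/
lemma norm_prod_sub_prod_le {ι : Type*} (J : Finset ι) (z w : ι → ℂ) (hz : ∀ i ∈ J, ‖z i‖ ≤ 1)
    (hw : ∀ i ∈ J, ‖w i‖ ≤ 1) : ‖∏ i ∈ J, z i - ∏ i ∈ J, w i‖ ≤ ∑ i ∈ J, ‖z i - w i‖ := by
  classical
  induction J using Finset.induction_on with
  | empty => simp
  | insert a J ha ih =>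
    rw [Finset.prod_insert ha, Finset.prod_insert ha, Finset.sum_insert ha]
    have h1 := ih (fun i hi => hz i (Finset.mem_insert_of_mem hi))
      (fun i hi => hw i (Finset.mem_insert_of_mem hi))
    have h2 : ‖∏ i ∈ J, w i‖ ≤ 1 := by
      rw [norm_prod]
      exact Finset.prod_le_one (fun _ _ => norm_nonneg _)
        fun i hi => hw i (Finset.mem_insert_of_mem hi)
    have h3 : z a * ∏ i ∈ J, z i - w a * ∏ i ∈ J, w i =
        z a * (∏ i ∈ J, z i - ∏ i ∈ J, w i) + (z a - w a) * ∏ i ∈ J, w i := by ring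
    rw [h3]
    refine (norm_add_le _ _).trans ?_
    rw [norm_mul, norm_mul, add_comm]
    have h4 := hz a (Finset.mem_insert_self a J)
    gcongr
    · exact mul_le_of_le_one_right (norm_nonneg _) h2
    · exact (mul_le_of_le_one_left (norm_nonneg _) h4).trans h1

/-- Taylor's cubic error for small `x` and the trivial quadratic bound for large `x`. The factor
`min 1 |x|` keeps the error integrable with two moments only. -/
lemma norm_exp_mul_I_sub_le (x : ℝ) :
    ‖Complex.exp (x * Complex.I) - (1 + x * Complex.I - x ^ 2 / 2)‖ ≤ 4 * (x ^ 2 * min 1 |x|) := by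
  have hx : ‖(x * Complex.I : ℂ)‖ = |x| := by simp
  rcases le_total |x| 1 with h | h
  · rw [min_eq_right h]
    have h1 := Complex.exp_bound (x := x * Complex.I) (by rw [hx]; exact h) (n := 3) (by norm_num)
    have h2 : ∑ m ∈ Finset.range 3, (x * Complex.I : ℂ) ^ m / (m.factorial : ℂ) =
        1 + x * Complex.I - x ^ 2 / 2 := by
      simp [Finset.sum_range_succ, Nat.factorial, mul_pow]
      ring
    rw [h2, hx] at h1
    refine h1.trans ?_
    have h3 : |x| ^ 3 = x ^ 2 * |x| := by rw [← sq_abs x]; ring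
    rw [h3, mul_comm]
    have : 0 ≤ x ^ 2 * |x| := by positivity
    norm_num [Nat.factorial]
    nlinarith
  · rw [min_eq_left h, mul_one]
    have h1 : ‖Complex.exp (x * Complex.I)‖ = 1 := Complex.norm_exp_ofReal_mul_I x
    have h2 : ‖(1 + x * Complex.I - x ^ 2 / 2 : ℂ)‖ ≤ 1 + |x| + x ^ 2 / 2 := by
      refine (norm_sub_le _ _).trans (add_le_add ((norm_add_le _ _).trans ?_) ?_)
      · rw [hx, norm_one]
      · simp
    refine (norm_sub_le _ _).trans ?_
    rw [h1]
    nlinarith [sq_abs x]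

lemma abs_exp_neg_sub_le {x : ℝ} (hx : 0 ≤ x) : |Real.exp (-x) - (1 - x)| ≤ x ^ 2 := by
  have h1 := Real.add_one_le_exp (-x)
  rw [abs_of_nonneg (by linarith)]
  rcases le_total x 1 with h | h
  · have := Real.abs_exp_sub_one_sub_id_le (x := -x) (by rw [abs_neg, abs_of_nonneg hx]; exact h)
    have h2 := (abs_le.1 this).2
    nlinarith
  · have : Real.exp (-x) ≤ 1 := Real.exp_le_one_iff.2 (by linarith)
    nlinarith

namespace IsCenteredPair

variable {Ω : Type*} [MeasurableSpace Ω] {P : Measure Ω} {U e : ℕ → Ω → ℝ}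

lemma integrable_sq_mul_sq [IsProbabilityMeasure P] (h : IsCenteredPair P U e) :
    Integrable (fun ω => U 0 ω ^ 2 * e 0 ω ^ 2) P := by
  have h1 : IndepFun (fun ω => U 0 ω ^ 2) (fun ω => e 0 ω ^ 2) P :=
    h.indepFun.comp (φ := fun x => x ^ 2) (ψ := fun x => x ^ 2) (by fun_prop) (by fun_prop)
  exact h1.integrable_mul h.memLp_fst.integrable_sq h.memLp_snd.integrable_sq

lemma measurable_truncation (h : IsCenteredPair P U e) (w M : ℝ) :
    Measurable fun ω => min 1 (|w| * |U 0 ω| * (M + |e 0 ω|)) := by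
  have := h.measurable_fst 0
  have := h.measurable_snd 0
  fun_prop

lemma integrable_mul_truncation (h : IsCenteredPair P U e) {f : Ω → ℝ} (hf : Integrable f P)
    (w : ℝ) {M : ℝ} (hM : 0 ≤ M) :
    Integrable (fun ω => f ω * min 1 (|w| * |U 0 ω| * (M + |e 0 ω|))) P := by
  refine hf.mono (hf.aestronglyMeasurable.mul
    (h.measurable_truncation w M).aestronglyMeasurable) (ae_of_all _ fun ω => ?_)
  rw [norm_mul]
  refine mul_le_of_le_one_right (norm_nonneg _) ?_
  rw [Real.norm_of_nonneg (le_min zero_le_one (by positivity))]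
  exact min_le_left _ _

/-- This plays the role of Lindeberg's condition: the truncation factor is at most `1` and tends to
zero pointwise, so dominated convergence applies. -/
lemma tendsto_integral_mul_truncation (h : IsCenteredPair P U e) {f : Ω → ℝ}
    (hf : Integrable f P) {w M : ℕ → ℝ} (hM : ∀ n, 0 ≤ M n) (hw : Tendsto w atTop (𝓝 0))
    (hwM : Tendsto (fun n => w n * M n) atTop (𝓝 0)) :
    Tendsto (fun n => ∫ ω, f ω * min 1 (|w n| * |U 0 ω| * (M n + |e 0 ω|)) ∂P) atTop (𝓝 0) := by
  have hlim : Tendsto (fun n => ∫ ω, f ω * min 1 (|w n| * |U 0 ω| * (M n + |e 0 ω|)) ∂P) atTop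
      (𝓝 (∫ _, (0 : ℝ) ∂P)) := by
    refine tendsto_integral_of_dominated_convergence (fun ω => ‖f ω‖)
      (fun n => (h.integrable_mul_truncation hf (w n) (hM n)).aestronglyMeasurable) hf.norm
      (fun n => ae_of_all _ fun ω => ?_) (ae_of_all _ fun ω => ?_)
    · rw [norm_mul]
      refine mul_le_of_le_one_right (norm_nonneg _) ?_
      have := hM n
      rw [Real.norm_of_nonneg (le_min zero_le_one (by positivity))]
      exact min_le_left _ _
    · have h1 : Tendsto (fun n => |U 0 ω| * |w n * M n| + |U 0 ω| * |e 0 ω| * |w n|) atTop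
          (𝓝 (|U 0 ω| * |(0 : ℝ)| + |U 0 ω| * |e 0 ω| * |(0 : ℝ)|)) :=
        (hwM.abs.const_mul _).add (hw.abs.const_mul _)
      have h2 := ((tendsto_const_nhds (x := (1 : ℝ))).min h1).const_mul (f ω)
      simp only [abs_zero, mul_zero, add_zero, zero_le_one, min_eq_right] at h2
      refine h2.congr fun n => ?_
      rw [abs_mul, abs_of_nonneg (hM n)]
      congr 2
      ring
  simpa using hlim

/-- A second-order expansion of the characteristic function of a weighted term. -/
lemma norm_integral_exp_sub_le [IsProbabilityMeasure P] (h : IsCenteredPair P U e) (i : ℕ)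
    (w : ℝ) {c M : ℝ} (hc : |c| ≤ M) :
    ‖∫ ω, Complex.exp ((w * (U i ω * (c + 1 * e i ω)) : ℝ) * Complex.I) ∂P -
      ((1 - w ^ 2 * ((c ^ 2 + ∫ ω, e 0 ω ^ 2 ∂P) * ∫ ω, U 0 ω ^ 2 ∂P) / 2 : ℝ) : ℂ)‖ ≤
      8 * w ^ 2 * (c ^ 2 * ∫ ω, U 0 ω ^ 2 * min 1 (|w| * |U 0 ω| * (M + |e 0 ω|)) ∂P +
        ∫ ω, U 0 ω ^ 2 * e 0 ω ^ 2 * min 1 (|w| * |U 0 ω| * (M + |e 0 ω|)) ∂P) := by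
  have hM : 0 ≤ M := (abs_nonneg c).trans hc
  set T : Ω → ℝ := fun ω => w * (U i ω * (c + 1 * e i ω)) with hT
  set T₀ : Ω → ℝ := fun ω => w * (U 0 ω * (c + 1 * e 0 ω)) with hT₀
  have hTT : IdentDistrib T T₀ P P := (h.identDistrib_term i c 1).const_mul w
  have hTm : MemLp T₀ 2 P := (h.memLp_term 0 c 1).const_mul w
  have hexp : ∫ ω, Complex.exp ((T ω : ℝ) * Complex.I) ∂P =
      ∫ ω, Complex.exp ((T₀ ω : ℝ) * Complex.I) ∂P :=
    (hTT.comp (u := fun x : ℝ => Complex.exp (x * Complex.I)) (by fun_prop)).integral_eq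
  have hint : Integrable (fun ω => Complex.exp ((T₀ ω : ℝ) * Complex.I)) P := by
    refine Integrable.of_bound (C := 1) ?_ (ae_of_all _ fun ω => ?_)
    · exact (Complex.continuous_exp.comp_aestronglyMeasurable
        ((Complex.continuous_ofReal.comp_aestronglyMeasurable
          hTm.aestronglyMeasurable).mul_const _))
    · exact (Complex.norm_exp_ofReal_mul_I _).le
  have hint1 : Integrable (fun ω => ((T₀ ω : ℝ) : ℂ) * Complex.I) P :=
    (hTm.integrable (by norm_num)).ofReal.mul_const _
  have hint2 : Integrable (fun ω => ((T₀ ω : ℝ) : ℂ) ^ 2 / 2) P := by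
    have := (hTm.integrable_sq.ofReal (𝕜 := ℂ)).div_const 2
    simpa using this
  have hmean : ∫ ω, ((T₀ ω : ℝ) : ℂ) * Complex.I ∂P = 0 := by
    rw [integral_mul_const, integral_complex_ofReal, hT₀, integral_const_mul, h.integral_term]
    simp
  have hsq : ∫ ω, ((T₀ ω : ℝ) : ℂ) ^ 2 / 2 ∂P =
      ((w ^ 2 * ((c ^ 2 + ∫ ω, e 0 ω ^ 2 ∂P) * ∫ ω, U 0 ω ^ 2 ∂P) / 2 : ℝ) : ℂ) := by
    have h1 : ∀ ω, ((T₀ ω : ℝ) : ℂ) ^ 2 / 2 =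
        ((w ^ 2 * (U 0 ω * (c + 1 * e 0 ω)) ^ 2 / 2 : ℝ) : ℂ) := fun ω => by
      simp only [hT₀]; push_cast; ring
    simp_rw [h1]
    rw [integral_complex_ofReal, integral_div, integral_const_mul, h.integral_term_sq]
    simp
  have hlin : Integrable (fun ω => 1 + ((T₀ ω : ℝ) : ℂ) * Complex.I) P :=
    (integrable_const _).add hint1
  have hpoly : Integrable (fun ω => 1 + ((T₀ ω : ℝ) : ℂ) * Complex.I -
      ((T₀ ω : ℝ) : ℂ) ^ 2 / 2) P := hlin.sub hint2
  have hdiff : ∫ ω, Complex.exp ((T ω : ℝ) * Complex.I) ∂P -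
      ((1 - w ^ 2 * ((c ^ 2 + ∫ ω, e 0 ω ^ 2 ∂P) * ∫ ω, U 0 ω ^ 2 ∂P) / 2 : ℝ) : ℂ) =
      ∫ ω, (Complex.exp ((T₀ ω : ℝ) * Complex.I) -
        (1 + ((T₀ ω : ℝ) : ℂ) * Complex.I - ((T₀ ω : ℝ) : ℂ) ^ 2 / 2)) ∂P := by
    rw [integral_sub hint hpoly, integral_sub hlin hint2, integral_add (integrable_const _) hint1,
      hmean, hsq, hexp]
    simp
  rw [hdiff]
  set m : Ω → ℝ := fun ω => min 1 (|w| * |U 0 ω| * (M + |e 0 ω|)) with hm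
  have hA : Integrable (fun ω => U 0 ω ^ 2 * m ω) P :=
    h.integrable_mul_truncation h.memLp_fst.integrable_sq w hM
  have hB : Integrable (fun ω => U 0 ω ^ 2 * e 0 ω ^ 2 * m ω) P :=
    h.integrable_mul_truncation h.integrable_sq_mul_sq w hM
  have hbound : ∀ ω, ‖Complex.exp ((T₀ ω : ℝ) * Complex.I) -
        (1 + ((T₀ ω : ℝ) : ℂ) * Complex.I - ((T₀ ω : ℝ) : ℂ) ^ 2 / 2)‖ ≤
      8 * w ^ 2 * (c ^ 2 * (U 0 ω ^ 2 * m ω) + U 0 ω ^ 2 * e 0 ω ^ 2 * m ω) := by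
    intro ω
    refine (norm_exp_mul_I_sub_le (T₀ ω)).trans ?_
    -- Bounding `c` by `M` makes the truncation factor common to all terms of the sum.
    have h1 : |T₀ ω| ≤ |w| * |U 0 ω| * (M + |e 0 ω|) := by
      simp only [hT₀, abs_mul, one_mul]
      rw [mul_assoc]
      gcongr
      exact (abs_add_le _ _).trans (by gcongr)
    have h2 : min 1 |T₀ ω| ≤ m ω := min_le_min_left _ h1
    -- By `(c + e)² ≤ 2 (c² + e²)`; this `2` and the Taylor constant `4` make up the `8`.
    have h3 : T₀ ω ^ 2 ≤ 2 * w ^ 2 * U 0 ω ^ 2 * (c ^ 2 + e 0 ω ^ 2) := by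
      simp only [hT₀, one_mul]
      nlinarith [mul_nonneg (mul_nonneg (sq_nonneg w) (sq_nonneg (U 0 ω)))
        (sq_nonneg (c - e 0 ω))]
    have h4 : 0 ≤ min 1 |T₀ ω| := le_min zero_le_one (abs_nonneg _)
    calc 4 * (T₀ ω ^ 2 * min 1 |T₀ ω|)
        ≤ 4 * (2 * w ^ 2 * U 0 ω ^ 2 * (c ^ 2 + e 0 ω ^ 2) * m ω) := by gcongr
      _ = _ := by ring
  refine (norm_integral_le_of_norm_le (((hA.const_mul _).add hB).const_mul _)
    (ae_of_all _ hbound)).trans_eq ?_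
  have hA' : Integrable (fun ω => c ^ 2 * (U 0 ω ^ 2 * m ω)) P := hA.const_mul _
  rw [integral_const_mul]
  congr 1
  refine (integral_add hA' hB).trans ?_
  rw [integral_const_mul]

lemma integral_exp_sum (h : IsCenteredPair P U e) (J : Finset ℕ) (c : ℕ → ℝ) (w : ℝ) :
    ∫ ω, Complex.exp ((w * ∑ i ∈ J, U i ω * (c i + 1 * e i ω) : ℝ) * Complex.I) ∂P =
      ∏ i ∈ J, ∫ ω, Complex.exp ((w * (U i ω * (c i + 1 * e i ω)) : ℝ) * Complex.I) ∂P := by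
  have hm : ∀ i, Measurable fun ω => w * (U i ω * (c i + 1 * e i ω)) := fun i =>
    (h.measurable_term i (c i) 1).const_mul w
  have hind : iIndepFun (fun i ω => w * (U i ω * (c i + 1 * e i ω))) P :=
    (h.iIndepFun_term c 1).comp (fun _ x => w * x) fun i => by fun_prop
  have h1 := iIndepFun.charFun_map_fun_finsetSum_eq_prod (s := J) (P := P)
    (fun i _ => (hm i).aemeasurable) (hind.restrict J)
  have h2 := congrFun h1 1
  have h3 : ∀ f : Ω → ℝ, Measurable f →
      charFun (P.map f) 1 = ∫ ω, Complex.exp ((f ω : ℝ) * Complex.I) ∂P := by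
    intro f hf
    rw [charFun_apply_real, integral_map hf.aemeasurable (by fun_prop)]
    simp
  rw [Finset.prod_apply, h3 _ (Finset.measurable_fun_sum _ fun i _ => hm i)] at h2
  simp_rw [← Finset.mul_sum] at h2
  rw [h2]
  exact Finset.prod_congr rfl fun i _ => h3 _ (hm i)

/-- **Central limit theorem for weighted sums**: the characteristic function at `1` of
`w_n ∑ U_i (c_{n,i} + e_i)` converges to that of a centred Gaussian if the weighted shifts are
uniformly negligible. -/
theorem tendsto_integral_exp_sum [IsProbabilityMeasure P] (h : IsCenteredPair P U e)
    (J : ℕ → Finset ℕ) (c : ℕ → ℕ → ℝ) {w M : ℕ → ℝ} {A B : ℝ} (hM0 : ∀ n, 0 ≤ M n)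
    (hM : ∀ᶠ n in atTop, ∀ i ∈ J n, |c n i| ≤ M n) (hw : Tendsto w atTop (𝓝 0))
    (hwM : Tendsto (fun n => w n * M n) atTop (𝓝 0))
    (hA : Tendsto (fun n => w n ^ 2 * ∑ i ∈ J n, c n i ^ 2) atTop (𝓝 A))
    (hB : Tendsto (fun n => w n ^ 2 * ((J n).card : ℝ)) atTop (𝓝 B)) :
    Tendsto (fun n => ∫ ω, Complex.exp
        ((w n * ∑ i ∈ J n, U i ω * (c n i + 1 * e i ω) : ℝ) * Complex.I) ∂P) atTop
      (𝓝 ((Real.exp (-((A + B * ∫ ω, e 0 ω ^ 2 ∂P) * (∫ ω, U 0 ω ^ 2 ∂P) / 2)) : ℝ) : ℂ)) := by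
  set s := ∫ ω, e 0 ω ^ 2 ∂P with hs
  set q := ∫ ω, U 0 ω ^ 2 ∂P with hq
  have hs0 : 0 ≤ s := integral_nonneg fun ω => sq_nonneg _
  have hq0 : 0 ≤ q := integral_nonneg fun ω => sq_nonneg _
  set a : ℕ → ℝ := fun n =>
    ∫ ω, U 0 ω ^ 2 * min 1 (|w n| * |U 0 ω| * (M n + |e 0 ω|)) ∂P with ha
  set b : ℕ → ℝ := fun n =>
    ∫ ω, U 0 ω ^ 2 * e 0 ω ^ 2 * min 1 (|w n| * |U 0 ω| * (M n + |e 0 ω|)) ∂P with hb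
  have ha0 : Tendsto a atTop (𝓝 0) :=
    h.tendsto_integral_mul_truncation h.memLp_fst.integrable_sq hM0 hw hwM
  have hb0 : Tendsto b atTop (𝓝 0) :=
    h.tendsto_integral_mul_truncation h.integrable_sq_mul_sq hM0 hw hwM
  -- `v n i` is half the variance of the `i`-th scaled term, so each characteristic function is
  -- compared with `exp (-v n i)`.
  set v : ℕ → ℕ → ℝ := fun n i => w n ^ 2 * ((c n i ^ 2 + s) * q) / 2 with hv
  have hv0 : ∀ n i, 0 ≤ v n i := fun n i => by positivity
  set V : ℕ → ℝ := fun n => ∑ i ∈ J n, v n i with hV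
  have hVeq : ∀ n, V n = (w n ^ 2 * ∑ i ∈ J n, c n i ^ 2 + w n ^ 2 * ((J n).card : ℝ) * s) *
      q / 2 := by
    intro n
    simp only [hV, hv]
    rw [← Finset.sum_div, ← Finset.mul_sum, ← Finset.sum_mul, Finset.sum_add_distrib,
      Finset.sum_const, nsmul_eq_mul]
    ring
  have hVlim : Tendsto V atTop (𝓝 ((A + B * s) * q / 2)) := by
    rw [funext hVeq]
    exact ((hA.add (hB.mul_const s)).mul_const q).div_const 2
  have hmain : Tendsto (fun n => ((Real.exp (-V n) : ℝ) : ℂ)) atTop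
      (𝓝 ((Real.exp (-((A + B * s) * q / 2)) : ℝ) : ℂ)) :=
    (Complex.continuous_ofReal.tendsto _).comp ((Real.continuous_exp.tendsto _).comp hVlim.neg)
  refine hmain.congr_dist ?_
  -- A bound for `v n i` uniform in `i ∈ J n`. Since it tends to zero, `∑ v² ≤ g * V` vanishes.
  set g : ℕ → ℝ := fun n => ((w n * M n) ^ 2 + w n ^ 2 * s) * q / 2 with hg
  have hglim : Tendsto g atTop (𝓝 0) := by
    have := (((hwM.pow 2).add ((hw.pow 2).mul_const s)).mul_const q).div_const 2
    simpa [hg] using this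
  have hupper : Tendsto (fun n => 8 * ((w n ^ 2 * ∑ i ∈ J n, c n i ^ 2) * a n +
      (w n ^ 2 * ((J n).card : ℝ)) * b n) + g n * V n) atTop (𝓝 0) := by
    have := ((((hA.mul ha0).add (hB.mul hb0)).const_mul 8).add (hglim.mul hVlim))
    simpa using this
  refine squeeze_zero' (Eventually.of_forall fun n => dist_nonneg) ?_ hupper
  filter_upwards [hM] with n hn
  rw [dist_comm, dist_eq_norm, h.integral_exp_sum, hV, ← Finset.sum_neg_distrib, Real.exp_sum,
    Complex.ofReal_prod]
  refine (norm_prod_sub_prod_le _ _ _ (fun i _ => ?_) (fun i _ => ?_)).trans ?_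
  · refine (norm_integral_le_of_norm_le (integrable_const (1 : ℝ))
      (ae_of_all _ fun ω => (Complex.norm_exp_ofReal_mul_I _).le)).trans_eq ?_
    simp
  · rw [Complex.norm_real, Real.norm_of_nonneg (Real.exp_pos _).le]
    exact Real.exp_le_one_iff.2 (neg_nonpos.2 (hv0 n i))
  have hterm : ∀ i ∈ J n, ‖∫ ω, Complex.exp
        ((w n * (U i ω * (c n i + 1 * e i ω)) : ℝ) * Complex.I) ∂P -
        ((Real.exp (-v n i) : ℝ) : ℂ)‖ ≤
      8 * w n ^ 2 * (c n i ^ 2 * a n + b n) + g n * v n i := by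
    intro i hi
    have h1 := h.norm_integral_exp_sub_le i (w n) (hn i hi)
    have h2 : ‖((1 - w n ^ 2 * ((c n i ^ 2 + s) * q) / 2 : ℝ) : ℂ) -
        ((Real.exp (-v n i) : ℝ) : ℂ)‖ ≤ v n i ^ 2 := by
      rw [← Complex.ofReal_sub, Complex.norm_real, Real.norm_eq_abs, abs_sub_comm]
      exact abs_exp_neg_sub_le (hv0 n i)
    have h3 : v n i ≤ g n := by
      have h5 : c n i ^ 2 ≤ M n ^ 2 := sq_le_sq' (abs_le.1 (hn i hi)).1 (abs_le.1 (hn i hi)).2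
      simp only [hv, hg]
      rw [mul_pow, ← mul_assoc, ← mul_add]
      gcongr
    have h4 : v n i ^ 2 ≤ g n * v n i := by
      rw [sq]
      exact mul_le_mul_of_nonneg_right h3 (hv0 n i)
    refine (norm_sub_le_norm_sub_add_norm_sub _ _ _).trans (add_le_add h1 (h2.trans h4))
  refine (Finset.sum_le_sum hterm).trans_eq ?_
  rw [Finset.sum_add_distrib, ← Finset.mul_sum, ← Finset.mul_sum, Finset.sum_add_distrib,
    ← Finset.sum_mul, Finset.sum_const, nsmul_eq_mul]
  ring

end IsCenteredPair
/-! ### Events of probability tending to one -/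

/-- The events `E n` have (outer) probability tending to one. -/
def HighProb {Ω : Type*} [MeasurableSpace Ω] (P : Measure Ω) (E : ℕ → Ω → Prop) : Prop :=
  Tendsto (fun n => P {ω | ¬ E n ω}) atTop (𝓝 0)

section HighProb

variable {Ω : Type*} [MeasurableSpace Ω] {P : Measure Ω} {E F : ℕ → Ω → Prop}

lemma HighProb.and (hE : HighProb P E) (hF : HighProb P F) :
    HighProb P fun n ω => E n ω ∧ F n ω := by
  have h := Tendsto.add hE hF
  rw [add_zero] at h
  refine tendsto_of_tendsto_of_tendsto_of_le_of_le tendsto_const_nhds h (fun _ => zero_le)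
    fun n => (measure_mono fun ω hω => ?_).trans (measure_union_le _ _)
  simpa only [Set.mem_ofPred_eq, Set.mem_union, not_and_or] using hω

lemma HighProb.mono (hE : HighProb P E) (h : ∀ᶠ n in atTop, ∀ ω, E n ω → F n ω) :
    HighProb P F := by
  refine tendsto_of_tendsto_of_tendsto_of_le_of_le' tendsto_const_nhds hE
    (Eventually.of_forall fun _ => zero_le) ?_
  filter_upwards [h] with n hn
  exact measure_mono fun ω hω hE => hω (hn ω hE)

lemma highProb_of_ae (h : ∀ n, ∀ᵐ ω ∂P, E n ω) : HighProb P E := by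
  refine tendsto_const_nhds.congr fun n => ?_
  exact ((ae_iff.1 (h n))).symm

variable {V : Type*} [NormedAddCommGroup V]

lemma measure_lt_norm_le [IsFiniteMeasure P] {N : Ω → V}
    (hN : Integrable (fun ω => ‖N ω‖ ^ 2) P) {η : ℝ} (hη : 0 < η) :
    P {ω | ¬ ‖N ω‖ ≤ η} ≤ ENNReal.ofReal ((∫ ω, ‖N ω‖ ^ 2 ∂P) / η ^ 2) := by
  have h1 := mul_meas_ge_le_integral_of_nonneg
    (ae_of_all P fun ω => sq_nonneg ‖N ω‖) hN (η ^ 2)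
  have h2 : P {ω | ¬ ‖N ω‖ ≤ η} ≤ P {ω | η ^ 2 ≤ ‖N ω‖ ^ 2} := measure_mono fun ω hω => by
    simp only [Set.mem_ofPred_eq, not_le] at hω ⊢
    gcongr
  refine h2.trans ?_
  rw [← ofReal_measureReal (measure_ne_top _ _)]
  refine ENNReal.ofReal_le_ofReal ?_
  rw [le_div_iff₀ (by positivity), mul_comm]
  exact h1

/-- Chebyshev's inequality: convergence to zero in mean square implies smallness with high
probability. -/
lemma highProb_norm_le [IsFiniteMeasure P] {N : ℕ → Ω → V}
    (hN : ∀ n, Integrable (fun ω => ‖N n ω‖ ^ 2) P)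
    (hlim : Tendsto (fun n => ∫ ω, ‖N n ω‖ ^ 2 ∂P) atTop (𝓝 0)) {η : ℝ} (hη : 0 < η) :
    HighProb P fun n ω => ‖N n ω‖ ≤ η := by
  refine tendsto_of_tendsto_of_tendsto_of_le_of_le tendsto_const_nhds ?_ (fun _ => zero_le)
    fun n => measure_lt_norm_le (hN n) hη
  have := (ENNReal.continuous_ofReal.tendsto _).comp (hlim.div_const (η ^ 2))
  simpa [Function.comp_def] using this

lemma tendstoInMeasure_zero_of_highProb {R : ℕ → Ω → V}
    (h : ∀ η, 0 < η → HighProb P fun n ω => ‖R n ω‖ ≤ η) : TendstoInMeasure P R atTop 0 := by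
  rw [tendstoInMeasure_iff_norm]
  intro ε hε
  refine tendsto_of_tendsto_of_tendsto_of_le_of_le tendsto_const_nhds (h (ε / 2) (by positivity))
    (fun _ => zero_le) fun n => measure_mono fun ω hω => ?_
  simp only [Set.mem_ofPred_eq, Pi.zero_apply, sub_zero, not_le] at hω ⊢
  linarith

/-- If `R` is negligible relative to a sequence `W` bounded in mean square, then `R` converges to
zero in probability. -/
lemma tendstoInMeasure_zero_of_le_mul [IsFiniteMeasure P] {R W : ℕ → Ω → V} {C : ℝ}
    (hW : ∀ n, Integrable (fun ω => ‖W n ω‖ ^ 2) P)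
    (hC : ∀ᶠ n in atTop, ∫ ω, ‖W n ω‖ ^ 2 ∂P ≤ C)
    (h : ∀ η, 0 < η → HighProb P fun n ω => ‖R n ω‖ ≤ η * ‖W n ω‖) :
    TendstoInMeasure P R atTop 0 := by
  refine tendstoInMeasure_zero_of_highProb fun δ hδ => ENNReal.tendsto_nhds_zero.2 fun ε hε => ?_
  obtain ⟨ε', hε'0, hε'⟩ : ∃ ε' : ℝ, 0 < ε' ∧ ENNReal.ofReal ε' ≤ ε / 2 := by
    rcases eq_or_ne ε ⊤ with rfl | htop
    · exact ⟨1, one_pos, by simp [ENNReal.top_div_of_ne_top]⟩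
    · refine ⟨(ε / 2).toReal, ENNReal.toReal_pos ?_ ?_, ENNReal.ofReal_toReal_le⟩
      · simpa using hε.ne'
      · exact ENNReal.div_ne_top htop (by simp)
  -- By Chebyshev, `W` exceeds `L` with probability at most `C / L ^ 2`, which fixes `L` before `n`
  -- varies.
  have hlim : Tendsto (fun L : ℝ => C / L ^ 2) atTop (𝓝 0) :=
    (tendsto_pow_atTop two_ne_zero).const_div_atTop C
  obtain ⟨L, hL, hL0⟩ := ((hlim.eventually_le_const hε'0).and (eventually_gt_atTop 0)).exists
  have h1 := ENNReal.tendsto_nhds_zero.1 (h (δ / L) (by positivity)) (ε / 2)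
    (by simpa using hε.ne')
  filter_upwards [h1, hC] with n hn hCn
  have h2 : P {ω | ¬ ‖W n ω‖ ≤ L} ≤ ε / 2 := by
    refine ((measure_lt_norm_le (hW n) hL0).trans (ENNReal.ofReal_le_ofReal ?_)).trans hε'
    exact (div_le_div_of_nonneg_right hCn (by positivity)).trans hL
  calc P {ω | ¬ ‖R n ω‖ ≤ δ}
      ≤ P ({ω | ¬ ‖R n ω‖ ≤ δ / L * ‖W n ω‖} ∪ {ω | ¬ ‖W n ω‖ ≤ L}) := by
        refine measure_mono fun ω hω => ?_
        by_contra hcon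
        simp only [Set.mem_union, Set.mem_ofPred_eq, not_or, not_not] at hcon
        refine hω (hcon.1.trans ?_)
        rw [div_mul_eq_mul_div, div_le_iff₀ hL0]
        exact mul_le_mul_of_nonneg_left hcon.2 hδ.le
    _ ≤ ε / 2 + ε / 2 := (measure_union_le _ _).trans (add_le_add hn h2)
    _ = ε := ENNReal.add_halves ε

end HighProb

/-! ### Consequences of the model assumptions -/

lemma continuous_norm_toEuclideanCLM_sub {d : ℕ}
    (S : EuclideanSpace ℝ (Fin d) →L[ℝ] EuclideanSpace ℝ (Fin d)) :
    Continuous fun M : Fin d → Fin d → ℝ =>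
      ‖Matrix.toEuclideanCLM (𝕜 := ℝ) (Matrix.of M) - S‖ := by
  have hlin : IsLinearMap ℝ fun M : Fin d → Fin d → ℝ =>
      Matrix.toEuclideanCLM (𝕜 := ℝ) (Matrix.of M) :=
    ⟨fun a b => by rw [← Matrix.of_add_of, map_add], fun c a => by rw [← Matrix.smul_of, map_smul]⟩
  have h1 := (hlin.mk' _).continuous_of_finiteDimensional
  exact (h1.sub continuous_const).norm

/-- Compactness of the unit sphere turns positivity into a uniform lower bound; in dimension zero
the sphere is empty. -/
lemma exists_pos_le_inner_toEuclideanCLM {d : ℕ} {Sig : Matrix (Fin d) (Fin d) ℝ}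
    (hSig : Sig.PosDef) : ∃ c : ℝ, 0 < c ∧ ∀ v : EuclideanSpace ℝ (Fin d), ‖v‖ = 1 →
      c ≤ ⟪v, Matrix.toEuclideanCLM (𝕜 := ℝ) Sig v⟫ := by
  have hcont : Continuous fun v : EuclideanSpace ℝ (Fin d) =>
      ⟪v, Matrix.toEuclideanCLM (𝕜 := ℝ) Sig v⟫ := by fun_prop
  obtain ⟨c, hc, h⟩ := (isCompact_sphere (0 : EuclideanSpace ℝ (Fin d)) 1).exists_forall_le'
    hcont.continuousOn (a := 0) fun v hv => by
      rw [Matrix.inner_toEuclideanCLM]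
      have hv0 : v.ofLp ≠ 0 := by
        intro h0
        have : v = 0 := by ext j; simp [h0]
        simp [this] at hv
      simpa using hSig.dotProduct_mulVec_pos hv0
  exact ⟨c, hc, fun v hv => h v (by simpa using hv)⟩

/-- Sums over the observations numbered from `s` on. -/
lemma sum_filter_le_eq_sum_Ico {V : Type*} [AddCommMonoid V] (n s : ℕ) (f : ℕ → V) :
    ∑ i ∈ Finset.univ.filter (fun i : Fin n => s ≤ (i : ℕ)), f i = ∑ i ∈ Finset.Ico s n, f i := by
  rw [Finset.sum_filter, Fin.sum_univ_eq_sum_range (fun i => if s ≤ i then f i else 0) n,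
    ← Finset.sum_filter]
  congr 1
  ext i
  simp [and_comm]

lemma sum_filter_lt_eq_sum_range {V : Type*} [AddCommMonoid V] {n s : ℕ} (hs : s ≤ n)
    (f : ℕ → V) :
    ∑ i ∈ Finset.univ.filter (fun i : Fin n => (i : ℕ) < s), f i = ∑ i ∈ Finset.range s, f i := by
  rw [Finset.sum_filter, Fin.sum_univ_eq_sum_range (fun i => if i < s then f i else 0) n,
    ← Finset.sum_filter]
  congr 1
  ext i
  simp only [Finset.mem_filter, Finset.mem_range]
  omega

/-- Reduces second moments of vector sums to those of scalar pairs, one coordinate at a time. -/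
lemma norm_sq_eq_sum_inner {d : ℕ} (v : EuclideanSpace ℝ (Fin d)) :
    ‖v‖ ^ 2 = ∑ j, ⟪v, EuclideanSpace.single j (1 : ℝ)⟫ ^ 2 := by
  rw [EuclideanSpace.norm_sq_eq]
  simp [EuclideanSpace.inner_single_right]

lemma inner_weighted_sum {Ω : Type*} {d : ℕ} {X : ℕ → Ω → EuclideanSpace ℝ (Fin d)}
    {eps : ℕ → Ω → ℝ} (J : Finset ℕ) (c : ℕ → ℝ) (τ : ℝ) (u : EuclideanSpace ℝ (Fin d)) (ω : Ω) :
    ⟪∑ i ∈ J, (c i + τ * eps i ω) • X i ω, u⟫ =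
      ∑ i ∈ J, ⟪X i ω, u⟫ * (c i + τ * eps i ω) := by
  rw [sum_inner]
  exact Finset.sum_congr rfl fun i _ => by rw [real_inner_smul_left, mul_comm]

namespace IsStochasticModel

variable {Ω : Type*} [MeasurableSpace Ω] {P : Measure Ω} {d : ℕ}
  {X : ℕ → Ω → EuclideanSpace ℝ (Fin d)} {eps : ℕ → Ω → ℝ} {σ : ℝ} {κ γ : ℕ → ℝ}

/-- Projection onto an arbitrary direction `u`, as in the Cramér–Wold device, reduces the vector
model to scalar pairs. -/
lemma isCenteredPair [IsProbabilityMeasure P]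
    (h : IsStochasticModel P X eps σ κ γ) (u : EuclideanSpace ℝ (Fin d)) :
    IsCenteredPair P (fun i ω => ⟪X i ω, u⟫) eps := by
  have hm : Measurable fun x : EuclideanSpace ℝ (Fin d) => ⟪x, u⟫ := by fun_prop
  have hXe : ∀ i, IndepFun (X i) (eps i) P := fun i =>
    h.indep_X_eps.comp (φ := fun x : ℕ → EuclideanSpace ℝ (Fin d) => x i)
      (ψ := fun x : ℕ → ℝ => x i) (by fun_prop) (by fun_prop)
  refine ⟨fun i => hm.comp (h.measurable_X i), h.measurable_eps, ?_, fun i => ?_, ?_, ?_,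
    h.memLp_eps, ?_, h.mean_eps⟩
  · exact (iIndepFun_prodMk h.measurable_X h.measurable_eps h.indep_X h.indep_eps
      h.indep_X_eps).comp (fun _ (p : EuclideanSpace ℝ (Fin d) × ℝ) => (⟪p.1, u⟫, p.2))
      fun _ => by fun_prop
  · exact ((h.ident_X i).prodMk (h.ident_eps i) (hXe i) (hXe 0)).comp
      (u := fun p : EuclideanSpace ℝ (Fin d) × ℝ => (⟪p.1, u⟫, p.2)) (by fun_prop)
  · exact (hXe 0).comp (φ := fun x => ⟪x, u⟫) (ψ := id) hm measurable_id
  · exact h.memLp_X.inner_const u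
  · have := integral_inner (𝕜 := ℝ) (h.memLp_X.integrable (by norm_num)) u
    simp_rw [real_inner_comm]
    rw [this, h.mean_X, inner_zero_right]

lemma integral_eps_sq (h : IsStochasticModel P X eps σ κ γ) : ∫ ω, eps 0 ω ^ 2 ∂P = σ ^ 2 := by
  rw [← h.var_eps, variance_of_integral_eq_zero h.memLp_eps.aemeasurable h.mean_eps]

lemma memLp_coord (h : IsStochasticModel P X eps σ κ γ) (j : Fin d) :
    MemLp (fun ω => X 0 ω j) 2 P := by
  refine h.memLp_X.mono ?_ (ae_of_all _ fun ω => PiLp.norm_apply_le (X 0 ω) j)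
  have := h.measurable_X 0
  exact Measurable.aestronglyMeasurable (by fun_prop)

lemma integral_coord [IsProbabilityMeasure P]
    (h : IsStochasticModel P X eps σ κ γ) (j : Fin d) :
    ∫ ω, X 0 ω j ∂P = 0 := by
  have := (h.isCenteredPair (EuclideanSpace.single j 1)).mean_fst
  simpa [EuclideanSpace.inner_single_right] using this

lemma covMatrix_apply [IsProbabilityMeasure P]
    (h : IsStochasticModel P X eps σ κ γ) (j k : Fin d) :
    covMatrix P (X 0) j k = ∫ ω, X 0 ω j * X 0 ω k ∂P := by
  rw [covMatrix, Matrix.of_apply, covariance_eq_sub (h.memLp_coord j) (h.memLp_coord k),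
    h.integral_coord]
  simp

lemma integral_inner_sq [IsProbabilityMeasure P]
    (h : IsStochasticModel P X eps σ κ γ) (u : EuclideanSpace ℝ (Fin d)) :
    ∫ ω, ⟪X 0 ω, u⟫ ^ 2 ∂P = ⟪u, Matrix.toEuclideanCLM (𝕜 := ℝ) (covMatrix P (X 0)) u⟫ := by
  have h1 : ∀ ω, ⟪X 0 ω, u⟫ ^ 2 = ∑ j, ∑ k, u j * u k * (X 0 ω j * X 0 ω k) := by
    intro ω
    rw [sq, PiLp.inner_apply, Finset.sum_mul_sum]
    refine Finset.sum_congr rfl fun j _ => Finset.sum_congr rfl fun k _ => ?_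
    simp only [RCLike.inner_apply, conj_trivial]
    ring
  have hint : ∀ j k, Integrable (fun ω => u j * u k * (X 0 ω j * X 0 ω k)) P := fun j k =>
    ((h.memLp_coord j).integrable_mul (h.memLp_coord k)).const_mul _
  simp_rw [h1]
  rw [integral_finsetSum _ fun j _ => integrable_finsetSum _ fun k _ => hint j k,
    Matrix.inner_toEuclideanCLM]
  simp only [dotProduct, Matrix.mulVec, Finset.mul_sum]
  refine Finset.sum_congr rfl fun j _ => ?_
  rw [integral_finsetSum _ fun k _ => hint j k]
  refine Finset.sum_congr rfl fun k _ => ?_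
  rw [integral_const_mul, h.covMatrix_apply]
  ring

lemma integrable_norm_sum_sq [IsProbabilityMeasure P]
    (h : IsStochasticModel P X eps σ κ γ) (J : Finset ℕ) (c : ℕ → ℝ)
    (τ : ℝ) : Integrable (fun ω => ‖∑ i ∈ J, (c i + τ * eps i ω) • X i ω‖ ^ 2) P := by
  simp_rw [norm_sq_eq_sum_inner, inner_weighted_sum]
  exact integrable_finsetSum _ fun j _ =>
    ((h.isCenteredPair (EuclideanSpace.single j 1)).memLp_sum J c τ).integrable_sq

lemma integral_norm_sum_sq [IsProbabilityMeasure P]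
    (h : IsStochasticModel P X eps σ κ γ) (J : Finset ℕ) (c : ℕ → ℝ)
    (τ : ℝ) : ∫ ω, ‖∑ i ∈ J, (c i + τ * eps i ω) • X i ω‖ ^ 2 ∂P =
      (∑ i ∈ J, c i ^ 2 + J.card * (τ ^ 2 * σ ^ 2)) * ∫ ω, ‖X 0 ω‖ ^ 2 ∂P := by
  simp_rw [norm_sq_eq_sum_inner, inner_weighted_sum]
  rw [integral_finsetSum _ fun j _ =>
      ((h.isCenteredPair (EuclideanSpace.single j 1)).memLp_sum J c τ).integrable_sq,
    integral_finsetSum _ fun j _ =>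
      (h.isCenteredPair (EuclideanSpace.single j 1)).memLp_fst.integrable_sq, Finset.mul_sum]
  refine Finset.sum_congr rfl fun j _ => ?_
  rw [(h.isCenteredPair (EuclideanSpace.single j 1)).integral_sum_sq, h.integral_eps_sq,
    Finset.sum_add_distrib, Finset.sum_const, nsmul_eq_mul]

/-- The strong law of large numbers for the cross products of the covariates, with a negligible
number of initial observations left out. -/
lemma ae_tendsto_cross [IsProbabilityMeasure P]
    (h : IsStochasticModel P X eps σ κ γ) {s : ℕ → ℕ} (hs : ∀ n, s n ≤ n)
    (hs1 : Tendsto s atTop atTop)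
    (hs2 : (fun n => (s n : ℝ)) =o[atTop] fun n : ℕ => (n : ℝ)) (j k : Fin d) :
    ∀ᵐ ω ∂P, Tendsto (fun n : ℕ => (n : ℝ)⁻¹ * ∑ i ∈ Finset.Ico (s n) n, X i ω j * X i ω k) atTop
      (𝓝 (covMatrix P (X 0) j k)) := by
  have hm : Measurable fun x : EuclideanSpace ℝ (Fin d) => x j * x k := by fun_prop
  have hlln := strong_law_ae_real (μ := P) (fun i ω => X i ω j * X i ω k)
    ((h.memLp_coord j).integrable_mul (h.memLp_coord k))
    (fun a b hab => (h.indep_X.indepFun hab).comp hm hm) (fun i => (h.ident_X i).comp hm)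
  rw [← h.covMatrix_apply] at hlln
  filter_upwards [hlln] with ω hω
  -- The omitted initial sum over `n` is its own average, which converges since `s n → ∞`, times `s
  -- n / n → 0`.
  have h1 := (hω.comp hs1).mul hs2.tendsto_div_nhds_zero
  rw [mul_zero] at h1
  have h2 := hω.sub h1
  rw [sub_zero] at h2
  refine h2.congr fun n => ?_
  have h3 : (∑ i ∈ Finset.range (s n), X i ω j * X i ω k) / (s n : ℝ) * ((s n : ℝ) / n) =
      (∑ i ∈ Finset.range (s n), X i ω j * X i ω k) / n := by
    rcases Nat.eq_zero_or_pos (s n) with h0 | h0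
    · simp [h0]
    · have : (s n : ℝ) ≠ 0 := by positivity
      field_simp
  simp only [Function.comp_apply]
  rw [h3, ← sub_div, ← Finset.sum_range_add_sum_Ico _ (hs n), add_sub_cancel_left, div_eq_inv_mul]

/-- The normalized Gram matrix of the observations numbered from `s n` on is close to the
covariance matrix. -/
lemma highProb_gram_close [IsProbabilityMeasure P]
    (h : IsStochasticModel P X eps σ κ γ) {s : ℕ → ℕ} (hs : ∀ n, s n ≤ n)
    (hs1 : Tendsto s atTop atTop)
    (hs2 : (fun n => (s n : ℝ)) =o[atTop] fun n : ℕ => (n : ℝ)) {η : ℝ} (hη : 0 < η) :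
    HighProb P fun n ω => ‖(n : ℝ)⁻¹ • Matrix.toEuclideanCLM (𝕜 := ℝ)
      ((designMatrix (covariates X n ω)
        (Finset.univ.filter fun i : Fin n => s n ≤ (i : ℕ))).transpose *
      designMatrix (covariates X n ω) (Finset.univ.filter fun i : Fin n => s n ≤ (i : ℕ))) -
      Matrix.toEuclideanCLM (𝕜 := ℝ) (covMatrix P (X 0))‖ ≤ η := by
  set S := Matrix.toEuclideanCLM (𝕜 := ℝ) (covMatrix P (X 0)) with hS
  set M : ℕ → Ω → Fin d → Fin d → ℝ := fun n ω j k =>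
    (n : ℝ)⁻¹ * ∑ i ∈ Finset.Ico (s n) n, X i ω j * X i ω k with hM
  have hMm : ∀ n, Measurable (M n) := by
    intro n
    refine measurable_pi_iff.2 fun j => measurable_pi_iff.2 fun k => ?_
    refine (Finset.measurable_fun_sum _ fun i _ => ?_).const_mul _
    have := h.measurable_X i
    fun_prop
  have hφ := continuous_norm_toEuclideanCLM_sub S
  have hae : ∀ᵐ ω ∂P, Tendsto (fun n => ‖Matrix.toEuclideanCLM (𝕜 := ℝ) (Matrix.of (M n ω)) - S‖)
      atTop (𝓝 0) := by
    have h1 : ∀ᵐ ω ∂P, ∀ j k, Tendsto (fun n => M n ω j k) atTop (𝓝 (covMatrix P (X 0) j k)) :=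
      ae_all_iff.2 fun j => ae_all_iff.2 fun k => h.ae_tendsto_cross hs hs1 hs2 j k
    filter_upwards [h1] with ω hω
    have h2 : Tendsto (fun n => M n ω) atTop (𝓝 fun j k => covMatrix P (X 0) j k) :=
      tendsto_pi_nhds.2 fun j => tendsto_pi_nhds.2 fun k => hω j k
    have h3 := (hφ.tendsto _).comp h2
    have h4 : Matrix.of (fun j k => covMatrix P (X 0) j k) = covMatrix P (X 0) := rfl
    rw [h4, ← hS, sub_self, norm_zero] at h3
    exact h3
  have hmeas := tendstoInMeasure_of_tendsto_ae (μ := P) (g := fun _ => (0 : ℝ))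
    (fun n => (hφ.measurable.comp (hMm n)).aestronglyMeasurable) hae
  rw [tendstoInMeasure_iff_norm] at hmeas
  refine tendsto_of_tendsto_of_tendsto_of_le_of_le tendsto_const_nhds (hmeas η hη)
    (fun _ => zero_le) fun n => measure_mono fun ω hω => ?_
  simp only [Set.mem_ofPred_eq, not_le, Function.comp_apply, sub_zero, norm_norm] at hω ⊢
  refine hω.le.trans_eq ?_
  rw [← map_smul]
  congr 3
  ext j k
  simp only [Matrix.smul_apply, Matrix.mul_apply, Matrix.transpose_apply, designMatrix,
    Matrix.of_apply, smul_eq_mul, hM, covariates]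
  rw [← sum_filter_le_eq_sum_Ico n (s n) fun i => X i ω j * X i ω k,
    Finset.sum_coe_sort _ fun i : Fin n => X i ω j * X i ω k]

/-- The bounding sequence of the covariates is bounded away from zero. -/
lemma exists_le_κ [IsProbabilityMeasure P]
    (h : IsStochasticModel P X eps σ κ γ) (hd : 0 < d) :
    ∃ c : ℝ, 0 < c ∧ ∀ᶠ n in atTop, c ≤ κ n := by
  -- Otherwise `X 0` vanishes almost surely, contradicting a positive diagonal entry of the
  -- covariance matrix. If `κ n < c`, then `X 0` alone exceeds `κ n` with probability bounded below.
  obtain ⟨c, hc, hpos⟩ : ∃ c : ℝ, 0 < c ∧ 0 < P {ω | c < ‖X 0 ω‖} := by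
    by_contra! hcon
    have h0 : ∀ᵐ ω ∂P, X 0 ω = 0 := by
      have h1 : ∀ m : ℕ, ∀ᵐ ω ∂P, ‖X 0 ω‖ ≤ 1 / ((m : ℝ) + 1) := fun m => by
        rw [ae_iff]
        simpa using hcon (1 / ((m : ℝ) + 1)) (by positivity)
      filter_upwards [ae_all_iff.2 h1] with ω hω
      refine norm_eq_zero.1 (le_antisymm ?_ (norm_nonneg _))
      exact ge_of_tendsto' tendsto_one_div_add_atTop_nhds_zero_nat hω
    have h2 := h.posDef_cov.diag_pos (i := ⟨0, hd⟩)
    rw [h.covMatrix_apply] at h2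
    refine h2.ne' ?_
    rw [integral_eq_zero_of_ae]
    filter_upwards [h0] with ω hω
    simp [hω]
  refine ⟨c, hc, ?_⟩
  filter_upwards [h.max_X.eventually_lt_const hpos, eventually_gt_atTop 0] with n hn hn0
  by_contra! hlt
  refine absurd hn (not_lt.2 (measure_mono fun ω hω => ?_))
  exact ⟨0, hn0, hlt.trans hω⟩

end IsStochasticModel
noncomputable section

/-! ### Identification of the observations with large incidental parameters -/

/-- The observations numbered from `s` on. -/
def indicesFrom (n s : ℕ) : Finset (Fin n) := Finset.univ.filter fun i => s ≤ (i : ℕ)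

/-- The score `∑ (μᵢ + εᵢ) Xᵢ` of the observations without a large incidental parameter. -/
def score {Ω : Type*} {d : ℕ} (X : ℕ → Ω → EuclideanSpace ℝ (Fin d)) (eps : ℕ → Ω → ℝ)
    (mu : ℕ → ℕ → ℝ) (s₁ : ℕ → ℕ) (n : ℕ) (ω : Ω) : EuclideanSpace ℝ (Fin d) :=
  ∑ i ∈ Finset.Ico (s₁ n) n, (mu n i + 1 * eps i ω) • X i ω

/-- A sign of `x`, with value `1` at zero. -/
def unitSign (x : ℝ) : ℝ := if 0 ≤ x then 1 else -1

lemma abs_unitSign (x : ℝ) : |unitSign x| = 1 := by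
  rw [unitSign]; split_ifs <;> simp

lemma unitSign_mul_self (x : ℝ) : unitSign x * x = |x| := by
  rw [unitSign]
  split_ifs with h
  · rw [one_mul, abs_of_nonneg h]
  · rw [abs_of_neg (not_le.1 h), neg_one_mul]

/-- The sum `∑ ± Xᵢ` over the observations with a large incidental parameter, with the signs of
these parameters. -/
def signScore {Ω : Type*} {d : ℕ} (X : ℕ → Ω → EuclideanSpace ℝ (Fin d)) (eps : ℕ → Ω → ℝ)
    (mu : ℕ → ℕ → ℝ) (s₁ : ℕ → ℕ) (n : ℕ) (ω : Ω) : EuclideanSpace ℝ (Fin d) :=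
  ∑ i ∈ Finset.range (s₁ n), (unitSign (mu n i) + 0 * eps i ω) • X i ω

section Identification

variable {Ω : Type*} {d : ℕ} {X : ℕ → Ω → EuclideanSpace ℝ (Fin d)} {eps : ℕ → Ω → ℝ}
  {mu : ℕ → ℕ → ℝ} {s₁ : ℕ → ℕ} {beta : EuclideanSpace ℝ (Fin d)} {n : ℕ} {ω : Ω}

lemma response_sub_inner (b : EuclideanSpace ℝ (Fin d)) (i : Fin n) :
    response X eps mu beta n ω i - ⟪covariates X n ω i, b⟫ =
      mu n i + eps i ω - ⟪X i ω, b - beta⟫ := by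
  rw [response, covariates, inner_sub_right]
  ring

lemma compl_filter_lt (n s : ℕ) :
    (Finset.univ.filter fun i : Fin n => (i : ℕ) < s)ᶜ = indicesFrom n s := by
  ext i
  simp [indicesFrom]

/-- On the event that covariates, errors and scores behave as expected, the penalized estimator
detects exactly the large incidental parameters. -/
lemma zeroSet_eq_indicesFrom {m : Fin n → ℝ} {b : EuclideanSpace ℝ (Fin d)} {lam κ γ c : ℝ}
    (h : IsPenalizedEstimator (response X eps mu beta n ω) (covariates X n ω) lam m b)
    (hn : 0 < n) (hs : s₁ n ≤ n) (hγ : 0 < γ) (hκ : 0 < κ)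
    {S : EuclideanSpace ℝ (Fin d) →L[ℝ] EuclideanSpace ℝ (Fin d)} (hc : 0 < c)
    (hS : ∀ v, ‖v‖ = 1 → c ≤ ⟪v, S v⟫)
    (hX : ∀ i < n, ‖X i ω‖ ≤ κ) (heps : ∀ i < n, |eps i ω| ≤ γ) (hlam : 2 * γ + κ ≤ lam)
    (hlarge : ∀ i < s₁ n, lam + γ + κ < |mu n i|)
    (hsmall : ∀ i, s₁ n ≤ i → i < n → |mu n i| ≤ γ)
    (hG : ‖(n : ℝ)⁻¹ • Matrix.toEuclideanCLM (𝕜 := ℝ)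
      ((designMatrix (covariates X n ω) (indicesFrom n (s₁ n))).transpose *
        designMatrix (covariates X n ω) (indicesFrom n (s₁ n))) - S‖ ≤ c / 2)
    (hN : ‖(n : ℝ)⁻¹ • score X eps mu s₁ n ω‖ ≤ c / 16)
    (hT : ‖(lam / n) • signScore X eps mu s₁ n ω‖ ≤ c / 16) :
    zeroSet m = indicesFrom n (s₁ n) := by
  have hn' : (0 : ℝ) < n := by exact_mod_cast hn
  have hinner : ∀ i < n, ∀ v : EuclideanSpace ℝ (Fin d), ‖v‖ ≤ 1 → |⟪X i ω, v⟫| ≤ κ := by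
    intro i hi v hv
    refine (abs_real_inner_le_norm _ _).trans ?_
    calc ‖X i ω‖ * ‖v‖ ≤ κ * 1 := by
          have := hX i hi
          gcongr
      _ = κ := mul_one κ
  have hb : ‖b - beta‖ ≤ 1 := by
    refine h.norm_sub_le_one (by linarith) beta (Finset.univ.filter fun i : Fin n => (i : ℕ) < s₁ n)
      (fun i => unitSign (mu n i)) (fun i _ => abs_unitSign _) (fun i hi => ?_)
      (fun v hv i hi => ?_) (fun v hv => ?_)
    · have hi' : (i : ℕ) < s₁ n := by simpa using hi
      rw [response_sub_inner, sub_self, inner_zero_right, sub_zero, mul_add, unitSign_mul_self]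
      have h1 : |unitSign (mu n i) * eps i ω| ≤ γ := by
        rw [abs_mul, abs_unitSign, one_mul]
        exact heps i i.2
      linarith [hlarge i hi', neg_abs_le (unitSign (mu n i) * eps i ω)]
    · have hi' : s₁ n ≤ (i : ℕ) := by simpa using hi
      rw [response_sub_inner, sub_self, inner_zero_right, sub_zero]
      refine (abs_sub _ _).trans ?_
      have h1 := abs_add_le (mu n i) (eps i ω)
      have h2 := hinner i i.2 v hv.le
      have h3 : covariates X n ω i = X i ω := rfl
      rw [h3]
      linarith [hsmall i hi' i.2, heps i i.2]
    · rw [compl_filter_lt]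
      have e1 : ∑ i ∈ indicesFrom n (s₁ n), (response X eps mu beta n ω i -
          ⟪covariates X n ω i, beta⟫) * ⟪covariates X n ω i, v⟫ = ⟪score X eps mu s₁ n ω, v⟫ := by
        rw [score, inner_weighted_sum, ← sum_filter_le_eq_sum_Ico n (s₁ n)
          fun i => ⟪X i ω, v⟫ * (mu n i + 1 * eps i ω)]
        refine Finset.sum_congr rfl fun i _ => ?_
        rw [response_sub_inner, sub_self, inner_zero_right, sub_zero, one_mul, mul_comm]
        rfl
      have e2 : ∑ i ∈ Finset.univ.filter (fun i : Fin n => (i : ℕ) < s₁ n),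
          unitSign (mu n i) * ⟪covariates X n ω i, v⟫ = ⟪signScore X eps mu s₁ n ω, v⟫ := by
        rw [signScore, inner_weighted_sum, ← sum_filter_lt_eq_sum_range hs
          fun i => ⟪X i ω, v⟫ * (unitSign (mu n i) + 0 * eps i ω)]
        refine Finset.sum_congr rfl fun i _ => ?_
        rw [zero_mul, add_zero, mul_comm]
        rfl
      set G := Matrix.toEuclideanCLM (𝕜 := ℝ)
        ((designMatrix (covariates X n ω) (indicesFrom n (s₁ n))).transpose *
          designMatrix (covariates X n ω) (indicesFrom n (s₁ n))) with hGdef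
      have e3 : ∑ i ∈ indicesFrom n (s₁ n), ⟪covariates X n ω i, v⟫ ^ 2 = ⟪v, G v⟫ := by
        rw [hGdef, toEuclideanCLM_gram_apply, inner_sum]
        refine Finset.sum_congr rfl fun i _ => ?_
        rw [inner_smul_right, real_inner_comm, sq, real_inner_comm]
      have hcs : ∀ z : EuclideanSpace ℝ (Fin d), ⟪z, v⟫ ≤ ‖z‖ := fun z => by
        simpa [hv] using real_inner_le_norm z v
      have b1 : ⟪score X eps mu s₁ n ω, v⟫ ≤ n * (c / 16) := by
        have h1 := (hcs ((n : ℝ)⁻¹ • score X eps mu s₁ n ω)).trans hN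
        rwa [real_inner_smul_left, inv_mul_le_iff₀ hn'] at h1
      have b2 : lam * ⟪signScore X eps mu s₁ n ω, v⟫ ≤ n * (c / 16) := by
        have h1 := (hcs ((lam / n) • signScore X eps mu s₁ n ω)).trans hT
        rwa [real_inner_smul_left, div_mul_eq_mul_div, div_le_iff₀' hn'] at h1
      have b3 : n * (c / 2) ≤ ⟪v, G v⟫ := by
        have h1 : |⟪v, ((n : ℝ)⁻¹ • G - S) v⟫| ≤ c / 2 := by
          refine (abs_real_inner_le_norm _ _).trans ?_
          rw [hv, one_mul]
          refine (((n : ℝ)⁻¹ • G - S).le_opNorm v).trans ?_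
          rwa [hv, mul_one]
        have h2 : ⟪v, ((n : ℝ)⁻¹ • G - S) v⟫ = (n : ℝ)⁻¹ * ⟪v, G v⟫ - ⟪v, S v⟫ := by
          simp [inner_sub_right, inner_smul_right]
        rw [h2] at h1
        have h3 : c / 2 ≤ (n : ℝ)⁻¹ * ⟪v, G v⟫ := by linarith [(abs_le.1 h1).1, hS v hv]
        rwa [le_inv_mul_iff₀ hn'] at h3
      rw [e1, mul_assoc, e2, e3]
      -- The linear terms total at most `4 * (c / 16) = c / 4` times `n`, against at least `c / 2`
      -- times `n` from the quadratic form.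
      nlinarith [mul_pos hn' hc]
  -- The residual at `b` is `mu n i` up to `γ + κ`: it exceeds `lam` for large parameters and is at
  -- most `2 * γ + κ ≤ lam` for the others.
  ext i
  rw [zeroSet, Finset.mem_filter, h.eq_zero_iff i, response_sub_inner]
  have h1 := hinner i i.2 _ hb
  have h2 := heps i i.2
  simp only [indicesFrom, Finset.mem_filter, Finset.mem_univ, true_and]
  constructor
  · intro hle
    by_contra! hi
    have h3 := hlarge i hi
    have h4 : |mu n i| ≤ |mu n i + eps i ω - ⟪X i ω, b - beta⟫| + |eps i ω| +
        |⟪X i ω, b - beta⟫| := by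
      have h5 : mu n i = (mu n i + eps i ω - ⟪X i ω, b - beta⟫) - eps i ω +
        ⟪X i ω, b - beta⟫ := by ring
      calc |mu n i| = |(mu n i + eps i ω - ⟪X i ω, b - beta⟫) - eps i ω +
            ⟪X i ω, b - beta⟫| := by rw [← h5]
        _ ≤ _ := (abs_add_le _ _).trans (by gcongr; exact abs_sub _ _)
    linarith
  · intro hi
    have h3 := abs_add_le (mu n i) (eps i ω)
    have h4 := abs_sub (mu n i + eps i ω) ⟪X i ω, b - beta⟫
    linarith [hsmall i hi i.2]

end Identification

/-! ### Orders of magnitude -/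

section Orders

variable {mu : ℕ → ℕ → ℝ} {s₁ s₂ : ℕ → ℕ} {κ γ lam : ℕ → ℝ}

lemma IsIncidental.le (h : IsIncidental mu s₁ s₂ κ γ) (n : ℕ) : s₁ n ≤ n :=
  (Nat.le_add_right _ _).trans (h.card_le n)

lemma IsIncidental.abs_le (h : IsIncidental mu s₁ s₂ κ γ) (hγ : ∀ n, 0 < γ n) (n i : ℕ)
    (hi : s₁ n ≤ i) (hin : i < n) : |mu n i| ≤ γ n := by
  rcases lt_or_ge i (s₁ n + s₂ n) with h1 | h1
  · exact h.bounded_le n i hi h1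
  · rw [h.eq_zero n i h1 hin, abs_zero]
    exact (hγ n).le

lemma IsIncidental.sum_sq (h : IsIncidental mu s₁ s₂ κ γ) (n : ℕ) :
    ∑ i ∈ Finset.Ico (s₁ n) n, mu n i ^ 2 = boundedEuclideanNorm mu s₁ s₂ n ^ 2 := by
  rw [boundedEuclideanNorm, Real.sq_sqrt (Finset.sum_nonneg fun i _ => sq_nonneg _),
    ← Finset.sum_Ico_consecutive _ (Nat.le_add_right _ _) (h.card_le n)]
  refine add_eq_left.2 (Finset.sum_eq_zero fun i hi => ?_)
  rw [Finset.mem_Ico] at hi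
  rw [h.eq_zero n i hi.1 hi.2]
  simp

lemma IsIncidental.boundedEuclideanNorm_sq_le (h : IsIncidental mu s₁ s₂ κ γ) (n : ℕ) :
    boundedEuclideanNorm mu s₁ s₂ n ^ 2 ≤ s₂ n * γ n ^ 2 := by
  rw [boundedEuclideanNorm, Real.sq_sqrt (Finset.sum_nonneg fun i _ => sq_nonneg _)]
  have h1 : ∀ i ∈ Finset.Ico (s₁ n) (s₁ n + s₂ n), mu n i ^ 2 ≤ γ n ^ 2 := fun i hi => by
    rw [Finset.mem_Ico] at hi
    rw [← sq_abs]
    have := h.bounded_le n i hi.1 hi.2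
    gcongr
  refine (Finset.sum_le_card_nsmul _ _ _ h1).trans_eq ?_
  simp

lemma minLarge_nonneg (n : ℕ) : 0 ≤ minLarge mu s₁ n :=
  Real.iInf_nonneg fun _ => abs_nonneg _

lemma minLarge_le (n : ℕ) {i : ℕ} (hi : i < s₁ n) : minLarge mu s₁ n ≤ |mu n i| :=
  ciInf_le (f := fun i : Fin (s₁ n) => |mu n i|)
    ⟨0, by rintro _ ⟨i, rfl⟩; exact abs_nonneg _⟩ ⟨i, hi⟩

/-- Since `α > 2` strictly, `2 * γ` leaves a fixed fraction `1 - 2 / α` of `lam` free, which absorbs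
`κ = o(lam)`. -/
lemma IsRegularization.eventually_le (h : IsRegularization lam mu s₁ κ γ) (hγ : ∀ n, 0 < γ n) :
    ∀ᶠ n in atTop, 2 * γ n + κ n ≤ lam n := by
  obtain ⟨α, hα, hle⟩ := h.γ_le
  have hα0 : 0 < α := by linarith
  filter_upwards [h.κ_small.bound (c := 1 - 2 / α) (by
    rw [sub_pos, div_lt_one hα0]; exact hα)] with n hn
  have h1 : 0 < lam n := (mul_pos hα0 (hγ n)).trans_le (hle n)
  have h2 := (le_abs_self (κ n)).trans hn
  rw [Real.norm_of_nonneg h1.le] at h2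
  have h3 : γ n ≤ lam n / α := by
    rw [le_div_iff₀ hα0, mul_comm]
    exact hle n
  have h4 : 2 / α * lam n = 2 * (lam n / α) := by ring
  nlinarith

/-- The three terms use at most `1/4 + 1/8 + 1/8` of `minLarge`; strictness comes from `γ > 0`. -/
lemma IsRegularization.eventually_large (h : IsRegularization lam mu s₁ κ γ)
    (hmu : IsIncidental mu s₁ s₂ κ γ) (hγ : ∀ n, 0 < γ n) :
    ∀ᶠ n in atTop, ∀ i < s₁ n, lam n + γ n + κ n < |mu n i| := by
  filter_upwards [h.lam_small.bound (c := 1 / 4) (by norm_num),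
    hmu.large.bound (c := 1 / 8) (by norm_num)] with n h1 h2 i hi
  have h0 := minLarge_nonneg (mu := mu) (s₁ := s₁) n
  have h3 := minLarge_le (mu := mu) n hi
  rw [Real.norm_of_nonneg (le_min h0 (Real.sqrt_nonneg _))] at h1
  rw [Real.norm_of_nonneg h0] at h2
  have h4 := (le_abs_self (lam n)).trans h1
  have h5 := (le_abs_self (max (κ n) (γ n))).trans h2
  have h6 := min_le_left (minLarge mu s₁ n) (Real.sqrt n)
  have h7 := le_max_left (κ n) (γ n)
  have h8 := le_max_right (κ n) (γ n)
  have := hγ n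
  linarith

lemma IsRegularization.tendsto_div_sqrt (h : IsRegularization lam mu s₁ κ γ) :
    Tendsto (fun n : ℕ => lam n / Real.sqrt n) atTop (𝓝 0) := by
  refine (h.lam_small.trans_isBigO (IsBigO.of_bound 1 (Eventually.of_forall fun n => ?_)))
    |>.tendsto_div_nhds_zero
  rw [Real.norm_of_nonneg (le_min (minLarge_nonneg n) (Real.sqrt_nonneg _)),
    Real.norm_of_nonneg (Real.sqrt_nonneg _), one_mul]
  exact min_le_right _ _

/-- The `ℓ_q` norm dominates the maximum, so it serves as the uniform bound `M` under assumption
(A). -/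
lemma abs_le_boundedNorm {q : ℝ} (hq : 0 < q) {n i : ℕ} (hi : s₁ n ≤ i) (hi' : i < s₁ n + s₂ n) :
    |mu n i| ≤ boundedNorm q mu s₁ s₂ n := by
  have h1 : |mu n i| ^ q ≤ ∑ i ∈ Finset.Ico (s₁ n) (s₁ n + s₂ n), |mu n i| ^ q :=
    Finset.single_le_sum (f := fun i => |mu n i| ^ q)
      (fun j _ => Real.rpow_nonneg (abs_nonneg _) q) (Finset.mem_Ico.2 ⟨hi, hi'⟩)
  have h2 := Real.rpow_le_rpow (Real.rpow_nonneg (abs_nonneg _) q) h1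
    (z := 1 / q) (by positivity)
  rwa [← Real.rpow_mul (abs_nonneg _), mul_one_div_cancel hq.ne', Real.rpow_one] at h2

end Orders

/-! ### Asymptotics of the two-step estimator -/

section Asymptotics

variable {Ω : Type*} [MeasurableSpace Ω] {P : Measure Ω} {d : ℕ}
  {X : ℕ → Ω → EuclideanSpace ℝ (Fin d)} {eps : ℕ → Ω → ℝ} {σ : ℝ}
  {mu : ℕ → ℕ → ℝ} {s₁ s₂ : ℕ → ℕ} {κ γ lam : ℕ → ℝ} {beta : EuclideanSpace ℝ (Fin d)}

lemma integrable_norm_smul_score_sq [IsProbabilityMeasure P]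
    (h : IsStochasticModel P X eps σ κ γ) (w : ℝ) (n : ℕ) :
    Integrable (fun ω => ‖w • score X eps mu s₁ n ω‖ ^ 2) P := by
  simp_rw [norm_smul, mul_pow]
  exact (h.integrable_norm_sum_sq _ _ 1).const_mul _

lemma integral_norm_smul_score_sq [IsProbabilityMeasure P]
    (h : IsStochasticModel P X eps σ κ γ)
    (hmu : IsIncidental mu s₁ s₂ κ γ) (w : ℝ) (n : ℕ) :
    ∫ ω, ‖w • score X eps mu s₁ n ω‖ ^ 2 ∂P =
      (w ^ 2 * boundedEuclideanNorm mu s₁ s₂ n ^ 2 + w ^ 2 * ((n - s₁ n : ℕ) : ℝ) * σ ^ 2) *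
        ∫ ω, ‖X 0 ω‖ ^ 2 ∂P := by
  simp_rw [norm_smul, mul_pow]
  rw [integral_const_mul]
  have h1 := h.integral_norm_sum_sq (Finset.Ico (s₁ n) n) (mu n) 1
  simp only [score]
  rw [h1, hmu.sum_sq, Nat.card_Ico, Real.norm_eq_abs, sq_abs]
  ring

lemma tendsto_mul_card_of_tendsto_mul (hmu : IsIncidental mu s₁ s₂ κ γ) {a : ℕ → ℝ} {B : ℝ}
    (ha : Tendsto (fun n : ℕ => a n * n) atTop (𝓝 B)) :
    Tendsto (fun n : ℕ => a n * ((n - s₁ n : ℕ) : ℝ)) atTop (𝓝 B) := by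
  have h1 := ha.sub (ha.mul hmu.s₁_small.tendsto_div_nhds_zero)
  rw [mul_zero, sub_zero] at h1
  refine h1.congr' ?_
  filter_upwards [eventually_gt_atTop 0] with n hn
  have : (n : ℝ) ≠ 0 := by positivity
  rw [Nat.cast_sub (hmu.le n)]
  field_simp

/-- The bound `D_n² / n² ≤ (γ / √n)² (s₂ / n)` is what makes the deterministic shifts harmless for
consistency. -/
lemma tendsto_boundedEuclideanNorm_div (h : IsStochasticModel P X eps σ κ γ)
    (hmu : IsIncidental mu s₁ s₂ κ γ) :
    Tendsto (fun n : ℕ => (n : ℝ)⁻¹ ^ 2 * boundedEuclideanNorm mu s₁ s₂ n ^ 2) atTop (𝓝 0) := by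
  have h1 := (h.γ_small.tendsto_div_nhds_zero.pow 2).mul hmu.s₂_small.tendsto_div_nhds_zero
  rw [mul_zero] at h1
  refine squeeze_zero (fun n => by positivity) (fun n => ?_) h1
  calc (n : ℝ)⁻¹ ^ 2 * boundedEuclideanNorm mu s₁ s₂ n ^ 2
      ≤ (n : ℝ)⁻¹ ^ 2 * (s₂ n * γ n ^ 2) := by
        gcongr
        exact hmu.boundedEuclideanNorm_sq_le n
    _ = (γ n / Real.sqrt n) ^ 2 * (s₂ n / n) := by
        rw [div_pow, Real.sq_sqrt (Nat.cast_nonneg n)]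
        ring

lemma tendsto_integral_norm_inv_smul_score_sq [IsProbabilityMeasure P]
    (h : IsStochasticModel P X eps σ κ γ)
    (hmu : IsIncidental mu s₁ s₂ κ γ) :
    Tendsto (fun n : ℕ => ∫ ω, ‖(n : ℝ)⁻¹ • score X eps mu s₁ n ω‖ ^ 2 ∂P) atTop (𝓝 0) := by
  simp_rw [integral_norm_smul_score_sq h hmu]
  have h1 : Tendsto (fun n : ℕ => (n : ℝ)⁻¹ ^ 2 * n) atTop (𝓝 0) := by
    refine tendsto_inv_atTop_nhds_zero_nat.congr fun n => ?_
    rcases eq_or_ne (n : ℝ) 0 with h0 | h0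
    · simp [h0]
    · field_simp
  have h2 := ((tendsto_boundedEuclideanNorm_div h hmu).add
    ((tendsto_mul_card_of_tendsto_mul hmu h1).mul_const (σ ^ 2))).mul_const
      (∫ ω, ‖X 0 ω‖ ^ 2 ∂P)
  simpa using h2

lemma integrable_norm_smul_signScore_sq [IsProbabilityMeasure P]
    (h : IsStochasticModel P X eps σ κ γ) (w : ℝ) (n : ℕ) :
    Integrable (fun ω => ‖w • signScore X eps mu s₁ n ω‖ ^ 2) P := by
  simp_rw [norm_smul, mul_pow]
  exact (h.integrable_norm_sum_sq _ _ 0).const_mul _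

/-- The second moment equals `(lam / √n)² (s₁ / n) E‖X 0‖²`, and both factors in front tend to zero.
-/
lemma tendsto_integral_norm_smul_signScore_sq [IsProbabilityMeasure P]
    (h : IsStochasticModel P X eps σ κ γ)
    (hmu : IsIncidental mu s₁ s₂ κ γ) (hlam : IsRegularization lam mu s₁ κ γ) :
    Tendsto (fun n : ℕ => ∫ ω, ‖(lam n / n) • signScore X eps mu s₁ n ω‖ ^ 2 ∂P) atTop
      (𝓝 0) := by
  have h1 := ((hlam.tendsto_div_sqrt.pow 2).mul hmu.s₁_small.tendsto_div_nhds_zero).mul_const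
    (∫ ω, ‖X 0 ω‖ ^ 2 ∂P)
  rw [mul_zero, zero_mul] at h1
  refine h1.congr fun n => ?_
  simp_rw [norm_smul, mul_pow]
  rw [integral_const_mul]
  have h2 := h.integral_norm_sum_sq (Finset.range (s₁ n)) (fun i => unitSign (mu n i)) 0
  have h3 : ∀ x, unitSign x ^ 2 = 1 := fun x => by rw [← sq_abs, abs_unitSign, one_pow]
  simp only [h3, Finset.sum_const, Finset.card_range, nsmul_eq_mul] at h2
  simp only [signScore]
  rw [h2, Real.norm_eq_abs, sq_abs, div_pow, Real.sq_sqrt (Nat.cast_nonneg n)]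
  ring

variable {muHat : (n : ℕ) → Ω → Fin n → ℝ} {betaHat : ℕ → Ω → EuclideanSpace ℝ (Fin d)}

/-- With high probability, the estimation error of the two-step estimator is close to its
linearization. -/
lemma highProb_twoStep_linearization [IsProbabilityMeasure P]
    (h : IsStochasticModel P X eps σ κ γ)
    (hmu : IsIncidental mu s₁ s₂ κ γ) (hlam : IsRegularization lam mu s₁ κ γ)
    (hmin : ∀ n, ∀ᵐ ω ∂P, IsPenalizedEstimator (response X eps mu beta n ω) (covariates X n ω)
      (lam n) (muHat n ω) (betaHat n ω)) {η : ℝ} (hη : 0 < η) :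
    HighProb P fun n ω =>
      ‖(twoStep (response X eps mu beta n ω) (covariates X n ω) (muHat n ω) - beta) -
        Matrix.toEuclideanCLM (𝕜 := ℝ) (covMatrix P (X 0))⁻¹
          ((n : ℝ)⁻¹ • score X eps mu s₁ n ω)‖ ≤
      η * ‖Matrix.toEuclideanCLM (𝕜 := ℝ) (covMatrix P (X 0))⁻¹
          ((n : ℝ)⁻¹ • score X eps mu s₁ n ω)‖ := by
  obtain ⟨c, hc, hcS⟩ := exists_pos_le_inner_toEuclideanCLM h.posDef_cov
  set S := Matrix.toEuclideanCLM (𝕜 := ℝ) (covMatrix P (X 0)) with hS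
  set Sinv := Matrix.toEuclideanCLM (𝕜 := ℝ) (covMatrix P (X 0))⁻¹ with hSinv
  have hSS : ∀ v, Sinv (S v) = v := fun v => by
    rw [← mul_apply_eq_comp, hSinv, hS, ← map_mul,
      Matrix.nonsing_inv_mul _ ((Matrix.isUnit_iff_isUnit_det _).1 h.posDef_cov.isUnit), map_one,
      one_apply_eq_self]
  obtain ⟨η', hη'0, hη'1, hη'2⟩ : ∃ η' : ℝ, 0 < η' ∧ ‖Sinv‖ * η' ≤ 1 / 2 ∧
      2 * (‖Sinv‖ * η') ≤ η := by
    have h0 := norm_nonneg Sinv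
    -- Adding `1` to `‖Sinv‖` avoids a zero denominator, as `Sinv` vanishes in dimension zero.
    refine ⟨min 1 η / (2 * (‖Sinv‖ + 1)), by positivity, ?_⟩
    have h1 : ‖Sinv‖ * (min 1 η / (2 * (‖Sinv‖ + 1))) ≤ min 1 η / 2 := by
      rw [mul_div_assoc', div_le_div_iff₀ (by positivity) (by positivity)]
      have : 0 ≤ min 1 η := by positivity
      nlinarith
    have h2 := min_le_left 1 η
    have h3 := min_le_right 1 η
    constructor <;> linarith
  have hX : HighProb P fun n ω => ∀ i < n, ‖X i ω‖ ≤ κ n := by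
    simpa [HighProb] using h.max_X
  have heps : HighProb P fun n ω => ∀ i < n, |eps i ω| ≤ γ n := by
    simpa [HighProb] using h.max_eps
  -- Closeness within `η'` serves the linearization, within `c / 2` the identification.
  have hG := h.highProb_gram_close hmu.le hmu.s₁_tendsto hmu.s₁_small
    (η := min η' (c / 2)) (by positivity)
  have hN := highProb_norm_le (fun n => integrable_norm_smul_score_sq h (n : ℝ)⁻¹ n)
    (tendsto_integral_norm_inv_smul_score_sq h hmu) (η := c / 16) (by positivity)
  have hT := highProb_norm_le (fun n => integrable_norm_smul_signScore_sq h (lam n / n) n)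
    (tendsto_integral_norm_smul_signScore_sq h hmu hlam) (η := c / 16) (by positivity)
  refine (((((hX.and heps).and hG).and hN).and hT).and (highProb_of_ae hmin)).mono ?_
  filter_upwards [hlam.eventually_le h.γ_pos, hlam.eventually_large hmu h.γ_pos,
    eventually_gt_atTop 0] with n hn1 hn2 hn0 ω ⟨⟨⟨⟨⟨hX, heps⟩, hG⟩, hN⟩, hT⟩, hest⟩
  rw [twoStep, zeroSet_eq_indicesFrom hest hn0 (hmu.le n) (h.γ_pos n) (h.κ_pos n) hc hcS hX heps
    hn1 hn2 (hmu.abs_le h.γ_pos n) (hG.trans (min_le_right _ _)) hN hT]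
  have hy : ∀ i ∈ indicesFrom n (s₁ n), response X eps mu beta n ω i =
      (mu n i + 1 * eps i ω) + ⟪covariates X n ω i, beta⟫ := fun i _ => by
    rw [response, covariates]
    ring
  have key := norm_olsOn_sub_sub_le (r := fun i : Fin n => mu n i + 1 * eps i ω) hy hSS hη'1
    (hG.trans (min_le_left _ _))
  have hsum : ∑ i ∈ indicesFrom n (s₁ n), (mu n i + 1 * eps i ω) • covariates X n ω i =
      score X eps mu s₁ n ω :=
    sum_filter_le_eq_sum_Ico n (s₁ n) fun i => (mu n i + 1 * eps i ω) • X i ω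
  rw [hsum] at key
  exact key.trans (mul_le_mul_of_nonneg_right hη'2 (norm_nonneg _))

/-- The two-step estimator is consistent. -/
lemma tendstoInMeasure_twoStep [IsProbabilityMeasure P]
    (h : IsStochasticModel P X eps σ κ γ)
    (hmu : IsIncidental mu s₁ s₂ κ γ) (hlam : IsRegularization lam mu s₁ κ γ)
    (hmin : ∀ n, ∀ᵐ ω ∂P, IsPenalizedEstimator (response X eps mu beta n ω) (covariates X n ω)
      (lam n) (muHat n ω) (betaHat n ω)) :
    TendstoInMeasure P (fun n ω =>
      twoStep (response X eps mu beta n ω) (covariates X n ω) (muHat n ω)) atTop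
      fun _ => beta := by
  set Sinv := Matrix.toEuclideanCLM (𝕜 := ℝ) (covMatrix P (X 0))⁻¹ with hSinv
  have key : TendstoInMeasure P (fun n ω =>
      twoStep (response X eps mu beta n ω) (covariates X n ω) (muHat n ω) - beta) atTop 0 := by
    refine tendstoInMeasure_zero_of_highProb fun η hη => ?_
    have hN := highProb_norm_le (fun n => integrable_norm_smul_score_sq h (n : ℝ)⁻¹ n)
      (tendsto_integral_norm_inv_smul_score_sq h hmu) (η := η / (2 * (‖Sinv‖ + 1)))
      (by positivity)
    refine ((highProb_twoStep_linearization h hmu hlam hmin one_pos).and hN).mono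
      (Eventually.of_forall fun n ω ⟨h1, h2⟩ => ?_)
    rw [← hSinv, one_mul] at h1
    generalize (n : ℝ)⁻¹ • score X eps mu s₁ n ω = z at *
    have h3 : ‖Sinv z‖ ≤ η / 2 := by
      calc ‖Sinv z‖ ≤ ‖Sinv‖ * ‖z‖ := Sinv.le_opNorm z
        _ ≤ (‖Sinv‖ + 1) * (η / (2 * (‖Sinv‖ + 1))) := by gcongr; linarith
        _ = η / 2 := by
          have : ‖Sinv‖ + 1 ≠ 0 := by positivity
          field_simp
    have h4 := norm_le_norm_sub_add (twoStep (response X eps mu beta n ω) (covariates X n ω)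
      (muHat n ω) - beta) (Sinv z)
    linarith
  rw [tendstoInMeasure_iff_norm] at key ⊢
  simpa using key

/-- Lévy's continuity theorem; the characteristic function of `Z n` at `t` is that of `⟪Z n, t⟫` at
`1`. -/
lemma tendstoNormal_of_charFun [IsProbabilityMeasure P]
    {Z : ℕ → Ω → EuclideanSpace ℝ (Fin d)}
    {S : Matrix (Fin d) (Fin d) ℝ} (hS : S.PosSemidef) (hZ : ∀ n, AEMeasurable (Z n) P)
    (h : ∀ t : EuclideanSpace ℝ (Fin d), Tendsto
      (fun n => ∫ ω, Complex.exp ((⟪Z n ω, t⟫ : ℝ) * Complex.I) ∂P) atTop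
      (𝓝 ((Real.exp (-(t.ofLp ⬝ᵥ S.mulVec t.ofLp) / 2) : ℝ) : ℂ))) :
    TendstoNormal P Z S := by
  refine ⟨hZ, aemeasurable_id, ProbabilityMeasure.tendsto_iff_tendsto_charFun.2 fun t => ?_⟩
  have h1 : charFun ((multivariateGaussian 0 S).map id) t =
      ((Real.exp (-(t.ofLp ⬝ᵥ S.mulVec t.ofLp) / 2) : ℝ) : ℂ) := by
    rw [Measure.map_id, charFun_multivariateGaussian hS, inner_zero_right, neg_div]
    push_cast
    simp
  simp only [ProbabilityMeasure.coe_mk]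
  rw [h1]
  refine (h t).congr fun n => ?_
  rw [charFun_apply, integral_map (hZ n) (by fun_prop)]

lemma measurable_score (h : IsStochasticModel P X eps σ κ γ) (n : ℕ) :
    Measurable (score X eps mu s₁ n) := by
  refine Finset.measurable_fun_sum _ fun i _ => ?_
  have := h.measurable_X i
  have := h.measurable_eps i
  fun_prop

/-- Asymptotic normality of the linearized estimation error. -/
lemma tendstoNormal_linearization [IsProbabilityMeasure P]
    (h : IsStochasticModel P X eps σ κ γ)
    (hmu : IsIncidental mu s₁ s₂ κ γ) {w M : ℕ → ℝ} {A B : ℝ} (hM0 : ∀ n, 0 ≤ M n)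
    (hM : ∀ᶠ n in atTop, ∀ i ∈ Finset.Ico (s₁ n) n, |mu n i| ≤ M n)
    (hw : Tendsto w atTop (𝓝 0)) (hwM : Tendsto (fun n => w n * M n) atTop (𝓝 0))
    (hA : Tendsto (fun n => w n ^ 2 * boundedEuclideanNorm mu s₁ s₂ n ^ 2) atTop (𝓝 A))
    (hB : Tendsto (fun n : ℕ => w n ^ 2 * n) atTop (𝓝 B)) :
    TendstoNormal P (fun n ω => Matrix.toEuclideanCLM (𝕜 := ℝ) (covMatrix P (X 0))⁻¹
      (w n • score X eps mu s₁ n ω)) ((A + B * σ ^ 2) • (covMatrix P (X 0))⁻¹) := by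
  have hA0 : 0 ≤ A := ge_of_tendsto' hA fun n => by positivity
  have hB0 : 0 ≤ B := ge_of_tendsto' hB fun n => by positivity
  have hpos := h.posDef_cov
  refine tendstoNormal_of_charFun (hpos.inv.posSemidef.smul (by positivity)) (fun n => ?_)
    fun t => ?_
  · have := measurable_score (mu := mu) (s₁ := s₁) h n
    exact Measurable.aemeasurable (by fun_prop)
  set S := Matrix.toEuclideanCLM (𝕜 := ℝ) (covMatrix P (X 0)) with hS
  set Sinv := Matrix.toEuclideanCLM (𝕜 := ℝ) (covMatrix P (X 0))⁻¹ with hSinv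
  have hSS : S (Sinv t) = t := by
    rw [← mul_apply_eq_comp, hSinv, hS, ← map_mul,
      Matrix.mul_nonsing_inv _ ((Matrix.isUnit_iff_isUnit_det _).1 hpos.isUnit), map_one,
      one_apply_eq_self]
  have hsymm : ∀ z, ⟪Sinv z, t⟫ = ⟪z, Sinv t⟫ := by
    intro z
    have hH : (covMatrix P (X 0))⁻¹.transpose = (covMatrix P (X 0))⁻¹ := by
      simpa [Matrix.IsHermitian] using hpos.inv.isHermitian
    rw [real_inner_comm, hSinv, Matrix.inner_toEuclideanCLM, Matrix.inner_toEuclideanCLM,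
      Matrix.dotProduct_mulVec, ← Matrix.mulVec_transpose, hH, dotProduct_comm]
  -- By symmetry of the inverse, the limit in direction `t` is a scalar one in direction `Sinv t`,
  -- whose variance `tᵀ S⁻¹ S S⁻¹ t` collapses to `tᵀ S⁻¹ t`.
  have hq : ∫ ω, ⟪X 0 ω, Sinv t⟫ ^ 2 ∂P =
      t.ofLp ⬝ᵥ (covMatrix P (X 0))⁻¹.mulVec t.ofLp := by
    rw [h.integral_inner_sq, ← hS, hSS, hsymm, hSinv, Matrix.inner_toEuclideanCLM]
  have hclt := (h.isCenteredPair (Sinv t)).tendsto_integral_exp_sum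
    (fun n => Finset.Ico (s₁ n) n) mu hM0 hM hw hwM (A := A) (B := B)
    (by simpa only [hmu.sum_sq] using hA)
    (by simpa only [Nat.card_Ico] using tendsto_mul_card_of_tendsto_mul hmu hB)
  rw [h.integral_eps_sq, hq] at hclt
  have hval : -(t.ofLp ⬝ᵥ ((A + B * σ ^ 2) • (covMatrix P (X 0))⁻¹).mulVec t.ofLp) / 2 =
      -((A + B * σ ^ 2) * (t.ofLp ⬝ᵥ (covMatrix P (X 0))⁻¹.mulVec t.ofLp) / 2) := by
    rw [Matrix.smul_mulVec, dotProduct_smul, smul_eq_mul]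
    ring
  rw [hval]
  refine hclt.congr fun n => ?_
  refine integral_congr_ae (ae_of_all _ fun ω => ?_)
  simp only
  rw [hsymm, real_inner_smul_left, score, inner_weighted_sum]

lemma measurable_estimator (h : IsStochasticModel P X eps σ κ γ)
    (hmeas : ∀ n, Measurable (muHat n)) (n : ℕ) : Measurable fun ω =>
      twoStep (response X eps mu beta n ω) (covariates X n ω) (muHat n ω) := by
  refine measurable_twoStep (measurable_pi_iff.2 fun i => ?_) (measurable_pi_iff.2 fun i => ?_)
    (hmeas n)
  · have := h.measurable_X i
    have := h.measurable_eps i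
    simp only [response]
    fun_prop
  · exact h.measurable_X i

/-- Asymptotic normality of the two-step estimator under a general scaling. -/
theorem tendstoNormal_twoStep [IsProbabilityMeasure P]
    (h : IsStochasticModel P X eps σ κ γ)
    (hmu : IsIncidental mu s₁ s₂ κ γ) (hlam : IsRegularization lam mu s₁ κ γ)
    (hmeas : ∀ n, Measurable (muHat n))
    (hmin : ∀ n, ∀ᵐ ω ∂P, IsPenalizedEstimator (response X eps mu beta n ω) (covariates X n ω)
      (lam n) (muHat n ω) (betaHat n ω)) {r M : ℕ → ℝ} {A B : ℝ} (hM0 : ∀ n, 0 ≤ M n)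
    (hM : ∀ᶠ n in atTop, ∀ i ∈ Finset.Ico (s₁ n) n, |mu n i| ≤ M n)
    (hr : Tendsto (fun n : ℕ => r n / n) atTop (𝓝 0))
    (hrM : Tendsto (fun n : ℕ => r n / n * M n) atTop (𝓝 0))
    (hA : Tendsto (fun n : ℕ => (r n / n) ^ 2 * boundedEuclideanNorm mu s₁ s₂ n ^ 2) atTop (𝓝 A))
    (hB : Tendsto (fun n : ℕ => (r n / n) ^ 2 * n) atTop (𝓝 B)) :
    TendstoNormal P (fun n ω => r n •
      (twoStep (response X eps mu beta n ω) (covariates X n ω) (muHat n ω) - beta))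
      ((A + B * σ ^ 2) • (covMatrix P (X 0))⁻¹) := by
  -- Slutsky's lemma: the remainder is an arbitrarily small multiple of a score bounded in mean
  -- square, hence vanishes in probability.
  refine tendstoInDistribution_of_tendstoInMeasure_sub _ _
    (tendstoNormal_linearization h hmu hM0 hM hr hrM hA hB) ?_
    fun n => ((measurable_estimator h hmeas n).sub_const beta).aemeasurable.const_smul (r n)
  set Sinv := Matrix.toEuclideanCLM (𝕜 := ℝ) (covMatrix P (X 0))⁻¹ with hSinv
  have hlim : Tendsto (fun n : ℕ => ∫ ω, ‖(r n / n) • score X eps mu s₁ n ω‖ ^ 2 ∂P) atTop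
      (𝓝 ((A + B * σ ^ 2) * ∫ ω, ‖X 0 ω‖ ^ 2 ∂P)) := by
    simp_rw [integral_norm_smul_score_sq h hmu]
    exact (hA.add ((tendsto_mul_card_of_tendsto_mul hmu hB).mul_const _)).mul_const _
  refine tendstoInMeasure_zero_of_le_mul (W := fun n ω => (r n / n) • score X eps mu s₁ n ω)
    (fun n => integrable_norm_smul_score_sq h _ n)
    (hlim.eventually_le_const (lt_add_one _)) fun η hη => ?_
  refine (highProb_twoStep_linearization h hmu hlam hmin (η := η / (‖Sinv‖ + 1))
    (by positivity)).mono (Eventually.of_forall fun n ω hω => ?_)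
  rw [← hSinv] at hω
  have h1 : (r n / n) • score X eps mu s₁ n ω = r n • (n : ℝ)⁻¹ • score X eps mu s₁ n ω := by
    rw [smul_smul, div_eq_mul_inv]
  simp only [Pi.sub_apply]
  rw [h1]
  generalize (n : ℝ)⁻¹ • score X eps mu s₁ n ω = z at *
  rw [map_smul, ← smul_sub, norm_smul, norm_smul]
  have h2 : η / (‖Sinv‖ + 1) * ‖Sinv z‖ ≤ η * ‖z‖ := by
    rw [div_mul_eq_mul_div, div_le_iff₀ (by positivity), mul_assoc]
    have h3 := Sinv.le_opNorm z
    have h4 := norm_nonneg z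
    exact mul_le_mul_of_nonneg_left (by nlinarith) hη.le
  calc ‖r n‖ * _ ≤ ‖r n‖ * (η * ‖z‖) := by gcongr; exact hω.trans h2
    _ = η * (‖r n‖ * ‖z‖) := by ring

/-- Asymptotic normality at the rate `√n`. -/
theorem tendstoNormal_sqrt_smul_twoStep [IsProbabilityMeasure P]
    (h : IsStochasticModel P X eps σ κ γ)
    (hmu : IsIncidental mu s₁ s₂ κ γ) (hlam : IsRegularization lam mu s₁ κ γ)
    (hmeas : ∀ n, Measurable (muHat n))
    (hmin : ∀ n, ∀ᵐ ω ∂P, IsPenalizedEstimator (response X eps mu beta n ω) (covariates X n ω)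
      (lam n) (muHat n ω) (betaHat n ω)) {c : ℝ}
    (hD : Tendsto (fun n : ℕ => boundedEuclideanNorm mu s₁ s₂ n ^ 2 / n) atTop (𝓝 c)) :
    TendstoNormal P (fun n ω => Real.sqrt n •
      (twoStep (response X eps mu beta n ω) (covariates X n ω) (muHat n ω) - beta))
      ((c + σ ^ 2) • (covMatrix P (X 0))⁻¹) := by
  have hsq : ∀ n : ℕ, Real.sqrt n / n = (Real.sqrt n)⁻¹ := fun n => Real.sqrt_div_self'.trans
    (one_div _)
  have h1 := tendstoNormal_twoStep h hmu hlam hmeas hmin (r := fun n => Real.sqrt n) (M := γ)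
    (A := c) (B := 1) (fun n => (h.γ_pos n).le) (Eventually.of_forall fun n i hi => by
      rw [Finset.mem_Ico] at hi
      exact hmu.abs_le h.γ_pos n i hi.1 hi.2) ?_ ?_ ?_ ?_
  · rwa [one_mul] at h1
  · simp_rw [hsq]
    exact tendsto_inv_atTop_zero.comp (Real.tendsto_sqrt_atTop.comp tendsto_natCast_atTop_atTop)
  · refine h.γ_small.tendsto_div_nhds_zero.congr fun n => ?_
    rw [hsq, div_eq_inv_mul]
  · refine hD.congr fun n => ?_
    rw [hsq, inv_pow, Real.sq_sqrt (Nat.cast_nonneg n), div_eq_inv_mul]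
  · refine tendsto_const_nhds.congr' ?_
    filter_upwards [eventually_gt_atTop 0] with n hn
    have : (n : ℝ) ≠ 0 := by positivity
    rw [hsq, inv_pow, Real.sq_sqrt (Nat.cast_nonneg n), inv_mul_cancel₀ this]

/-- Asymptotic normality at the rate `n / D_n` when the bounded incidental parameters dominate. -/
theorem tendstoNormal_smul_twoStep_of_tendsto_atTop [IsProbabilityMeasure P]
    (h : IsStochasticModel P X eps σ κ γ)
    (hmu : IsIncidental mu s₁ s₂ κ γ) (hlam : IsRegularization lam mu s₁ κ γ)
    (hmeas : ∀ n, Measurable (muHat n))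
    (hmin : ∀ n, ∀ᵐ ω ∂P, IsPenalizedEstimator (response X eps mu beta n ω) (covariates X n ω)
      (lam n) (muHat n ω) (betaHat n ω)) (hassump : AssumptionA P X mu s₁ s₂)
    (hD : Tendsto (fun n : ℕ => boundedEuclideanNorm mu s₁ s₂ n ^ 2 / n) atTop atTop) {r : ℕ → ℝ}
    (hr : IsEquivalent atTop r fun n : ℕ => (n : ℝ) / boundedEuclideanNorm mu s₁ s₂ n) :
    (r =o[atTop] fun n : ℕ => Real.sqrt n) ∧
      TendstoNormal P (fun n ω => r n •
        (twoStep (response X eps mu beta n ω) (covariates X n ω) (muHat n ω) - beta))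
        (covMatrix P (X 0))⁻¹ := by
  set D := boundedEuclideanNorm mu s₁ s₂ with hDdef
  have hD0 : ∀ n, 0 ≤ D n := fun n => Real.sqrt_nonneg _
  -- Divergence of `D_n² / n` forces `D_n ≥ √n > 0` eventually, which justifies all later divisions
  -- by `D_n`.
  have hev : ∀ᶠ n : ℕ in atTop, 0 < (n : ℝ) ∧ 0 < D n ∧ Real.sqrt n ≤ D n := by
    filter_upwards [hD.eventually_ge_atTop 1, eventually_gt_atTop 0] with n h1 hn
    have hn' : (0 : ℝ) < n := by exact_mod_cast hn
    rw [le_div_iff₀ hn', one_mul] at h1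
    have h2 : Real.sqrt n ≤ D n := (Real.sqrt_le_left (hD0 n)).2 h1
    exact ⟨hn', (Real.sqrt_pos.2 hn').trans_le h2, h2⟩
  have hsqrt : Tendsto (fun n : ℕ => Real.sqrt n) atTop atTop :=
    Real.tendsto_sqrt_atTop.comp tendsto_natCast_atTop_atTop
  have hDtop : Tendsto D atTop atTop :=
    tendsto_atTop_mono' _ (hev.mono fun n hn => hn.2.2) hsqrt
  have hratio : Tendsto (fun n => r n / n * D n) atTop (𝓝 1) := by
    refine ((isEquivalent_iff_tendsto_one (hev.mono fun n hn =>
      (div_pos hn.1 hn.2.1).ne')).1 hr).congr fun n => ?_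
    rw [Pi.div_apply, div_div_eq_mul_div, div_mul_eq_mul_div]
  have hnD : Tendsto (fun n : ℕ => (D n ^ 2 / n)⁻¹) atTop (𝓝 0) := tendsto_inv_atTop_zero.comp hD
  have hw : Tendsto (fun n => r n / n) atTop (𝓝 0) := by
    have h1 := hratio.mul (tendsto_inv_atTop_zero.comp hDtop)
    rw [mul_zero] at h1
    refine h1.congr' (hev.mono fun n hn => ?_)
    have := hn.2.1.ne'
    simp only [Function.comp_apply]
    field_simp
  refine ⟨?_, ?_⟩
  · have h1 : Tendsto (fun n : ℕ => Real.sqrt ((D n ^ 2 / n)⁻¹)) atTop (𝓝 0) := by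
      rw [← Real.sqrt_zero]
      exact (Real.continuous_sqrt.tendsto _).comp hnD
    have h2 := hratio.mul h1
    rw [mul_zero] at h2
    refine (isLittleO_iff_tendsto' (hev.mono fun n hn h0 =>
      absurd h0 (Real.sqrt_pos.2 hn.1).ne')).2 (h2.congr' (hev.mono fun n hn => ?_))
    have h3 := hn.2.1.ne'
    have h4 := hn.1.ne'
    have h5 := (Real.sqrt_pos.2 hn.1).ne'
    rw [inv_div, Real.sqrt_div' _ (sq_nonneg _), Real.sqrt_sq (hD0 n)]
    have h6 := Real.sq_sqrt hn.1.le
    field_simp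
    linear_combination r n * h6
  · obtain ⟨δ, hδ, -, hδlim⟩ := hassump
    have hnonneg : ∀ n, 0 ≤ boundedNorm (2 + δ) mu s₁ s₂ n := fun n =>
      Real.rpow_nonneg (Finset.sum_nonneg fun i _ => Real.rpow_nonneg (abs_nonneg _) _) _
    -- `A = 1` normalizes the shifts, and `B = 0` because `(r / n)² n` behaves like `n / D_n²`: the
    -- noise disappears from the limit.
    have h1 := tendstoNormal_twoStep h hmu hlam hmeas hmin (r := r)
      (M := boundedNorm (2 + δ) mu s₁ s₂) (A := 1) (B := 0) hnonneg
      (Eventually.of_forall fun n i hi => ?_) hw ?_ ?_ ?_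
    · simpa using h1
    · rw [Finset.mem_Ico] at hi
      rcases lt_or_ge i (s₁ n + s₂ n) with h1 | h1
      · exact abs_le_boundedNorm (by linarith) hi.1 h1
      · rw [hmu.eq_zero n i h1 hi.2, abs_zero]
        exact hnonneg n
    · rw [← hDdef] at hδlim
      have h1 := hratio.mul (tendsto_inv_atTop_zero.comp hδlim)
      rw [mul_zero] at h1
      refine h1.congr' (hev.mono fun n hn => ?_)
      have := hn.2.1.ne'
      simp only [Function.comp_apply, inv_div]
      field_simp
    · have h1 := hratio.pow 2
      rw [one_pow] at h1
      exact h1.congr fun n => mul_pow _ _ _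
    · have h1 := (hratio.pow 2).mul hnD
      rw [mul_zero] at h1
      refine h1.congr' (hev.mono fun n hn => ?_)
      have := hn.2.1.ne'
      have := hn.1.ne'
      field_simp

/-- Few bounded incidental parameters have a negligible Euclidean norm. -/
lemma tendsto_boundedEuclideanNorm_sq_div [IsProbabilityMeasure P]
    (h : IsStochasticModel P X eps σ κ γ)
    (hmu : IsIncidental mu s₁ s₂ κ γ) (hd : 0 < d)
    (hs : (fun n => (s₂ n : ℝ)) =o[atTop] fun n : ℕ => Real.sqrt n / (κ n * γ n)) :
    Tendsto (fun n : ℕ => boundedEuclideanNorm mu s₁ s₂ n ^ 2 / n) atTop (𝓝 0) := by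
  obtain ⟨c, hc, hκ⟩ := h.exists_le_κ hd
  -- Factors `s₂ γ² / n` as `(s₂ κ γ / √n) * (γ / √n) / κ`, with `1 / κ` bounded by `c⁻¹`.
  have h1 := ((hs.tendsto_div_nhds_zero).mul h.γ_small.tendsto_div_nhds_zero).mul_const c⁻¹
  rw [mul_zero, zero_mul] at h1
  refine squeeze_zero' (Eventually.of_forall fun n => by positivity) ?_ h1
  filter_upwards [hκ, eventually_gt_atTop 0] with n hn hn0
  have hn' : (0 : ℝ) < n := by exact_mod_cast hn0
  have hsq := Real.sqrt_pos.2 hn'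
  have hγ := h.γ_pos n
  have hκ0 := h.κ_pos n
  have e1 : (s₂ n : ℝ) / (Real.sqrt n / (κ n * γ n)) * (γ n / Real.sqrt n) * c⁻¹ =
      (s₂ n * γ n ^ 2 / n) * (κ n / c) := by
    have h2 := Real.sq_sqrt hn'.le
    field_simp
    rw [h2]
  rw [e1]
  calc boundedEuclideanNorm mu s₁ s₂ n ^ 2 / n ≤ s₂ n * γ n ^ 2 / n := by
        gcongr
        exact hmu.boundedEuclideanNorm_sq_le n
    _ ≤ (s₂ n * γ n ^ 2 / n) * (κ n / c) :=
        le_mul_of_one_le_right (by positivity) ((one_le_div hc).2 hn)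

/-- In dimension zero every sequence converges to the degenerate normal distribution. -/
lemma tendstoNormal_of_dim_zero [IsProbabilityMeasure P]
    {Z : ℕ → Ω → EuclideanSpace ℝ (Fin d)} (hd : d = 0)
    {S : Matrix (Fin d) (Fin d) ℝ} : TendstoNormal P Z S := by
  subst hd
  have hZ : ∀ n, AEMeasurable (Z n) P := fun n =>
    (measurable_of_subsingleton_codomain _).aemeasurable
  refine ⟨hZ, aemeasurable_id, ProbabilityMeasure.tendsto_iff_tendsto_charFun.2 fun t => ?_⟩
  rw [Subsingleton.elim t 0]
  simp only [charFun_zero, ProbabilityMeasure.coe_mk]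
  refine tendsto_const_nhds.congr fun n => ?_
  have := Measure.isProbabilityMeasure_map (hZ n)
  have := Measure.isProbabilityMeasure_map (μ := multivariateGaussian 0 S)
    (aemeasurable_id (α := EuclideanSpace ℝ (Fin 0)))
  simp

end Asymptotics

end

end IncidentalRegression

/-! ### Assembly of the theorem. -/

theorem theorem3p8 {Ω : Type*} [MeasurableSpace Ω] (P : Measure Ω) [IsProbabilityMeasure P]
    {d : ℕ} (X : ℕ → Ω → EuclideanSpace ℝ (Fin d)) (eps : ℕ → Ω → ℝ) (σ : ℝ)
    (beta : EuclideanSpace ℝ (Fin d)) (mu : ℕ → ℕ → ℝ) (s₁ s₂ : ℕ → ℕ) (κ γ lam : ℕ → ℝ)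
    (hmodel : IncidentalRegression.IsStochasticModel P X eps σ κ γ)
    (hmu : IncidentalRegression.IsIncidental mu s₁ s₂ κ γ)
    (hlam : IncidentalRegression.IsRegularization lam mu s₁ κ γ)
    (muHat : (n : ℕ) → Ω → Fin n → ℝ) (betaHat : ℕ → Ω → EuclideanSpace ℝ (Fin d))
    (hmeas : ∀ n, Measurable (muHat n))
    (hmin : ∀ n, ∀ᵐ ω ∂P, IncidentalRegression.IsPenalizedEstimator
      (IncidentalRegression.response X eps mu beta n ω) (IncidentalRegression.covariates X n ω)
      (lam n) (muHat n ω) (betaHat n ω))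
    (betaTilde : ℕ → Ω → EuclideanSpace ℝ (Fin d))
    (hTilde : ∀ n ω, betaTilde n ω = IncidentalRegression.twoStep
      (IncidentalRegression.response X eps mu beta n ω) (IncidentalRegression.covariates X n ω)
      (muHat n ω))
    (D : ℕ → ℝ) (hD : D = IncidentalRegression.boundedEuclideanNorm mu s₁ s₂)
    (Sig : Matrix (Fin d) (Fin d) ℝ) (hSig : Sig = IncidentalRegression.covMatrix P (X 0)) :
    ((((fun n => (s₂ n : ℝ)) =o[atTop] fun n : ℕ => (n : ℝ) / (κ n * γ n)) ∨
        IncidentalRegression.AssumptionA P X mu s₁ s₂) →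
      TendstoInMeasure P betaTilde atTop fun _ => beta) ∧
    (((fun n => (s₂ n : ℝ)) =o[atTop] fun n : ℕ => Real.sqrt n / (κ n * γ n)) →
      IncidentalRegression.TendstoNormal P
        (fun n ω => Real.sqrt n • (betaTilde n ω - beta)) (σ ^ 2 • Sig⁻¹)) ∧
    (IncidentalRegression.AssumptionA P X mu s₁ s₂ →
      (Tendsto (fun n : ℕ => D n ^ 2 / n) atTop (𝓝 0) →
        IncidentalRegression.TendstoNormal P
          (fun n ω => Real.sqrt n • (betaTilde n ω - beta)) (σ ^ 2 • Sig⁻¹)) ∧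
      (∀ c : ℝ, 0 < c → Tendsto (fun n : ℕ => D n ^ 2 / n) atTop (𝓝 c) →
        IncidentalRegression.TendstoNormal P
          (fun n ω => Real.sqrt n • (betaTilde n ω - beta)) ((c + σ ^ 2) • Sig⁻¹)) ∧
      (Tendsto (fun n : ℕ => D n ^ 2 / n) atTop atTop →
        ∀ r : ℕ → ℝ, IsEquivalent atTop r (fun n : ℕ => (n : ℝ) / D n) →
          (r =o[atTop] fun n : ℕ => Real.sqrt n) ∧
          IncidentalRegression.TendstoNormal P
            (fun n ω => r n • (betaTilde n ω - beta)) Sig⁻¹)) := by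
  subst hD hSig
  obtain rfl : betaTilde = fun n ω => IncidentalRegression.twoStep
      (IncidentalRegression.response X eps mu beta n ω) (IncidentalRegression.covariates X n ω)
      (muHat n ω) := by
    funext n ω
    exact hTilde n ω
  have hzero : Tendsto (fun n : ℕ =>
      IncidentalRegression.boundedEuclideanNorm mu s₁ s₂ n ^ 2 / n) atTop (𝓝 0) →
      IncidentalRegression.TendstoNormal P (fun n ω => Real.sqrt n • (IncidentalRegression.twoStep
        (IncidentalRegression.response X eps mu beta n ω) (IncidentalRegression.covariates X n ω)
        (muHat n ω) - beta)) (σ ^ 2 • (IncidentalRegression.covMatrix P (X 0))⁻¹) := fun h0 => by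
    simpa using
      IncidentalRegression.tendstoNormal_sqrt_smul_twoStep hmodel hmu hlam hmeas hmin h0
  refine ⟨fun _ => IncidentalRegression.tendstoInMeasure_twoStep hmodel hmu hlam hmin,
    fun hs => ?_, fun hA => ⟨hzero, fun c _ hc => ?_, fun hD r hr => ?_⟩⟩
  -- The lower bound on `κ` needs a nondegenerate covariate; in dimension zero the limit is trivial
  -- instead.
  · rcases Nat.eq_zero_or_pos d with hd | hd
    · exact IncidentalRegression.tendstoNormal_of_dim_zero hd
    · exact hzero (IncidentalRegression.tendsto_boundedEuclideanNorm_sq_div hmodel hmu hd hs)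
  · exact IncidentalRegression.tendstoNormal_sqrt_smul_twoStep hmodel hmu hlam hmeas hmin hc
  · exact IncidentalRegression.tendstoNormal_smul_twoStep_of_tendsto_atTop hmodel hmu hlam hmeas
      hmin hA hD hr
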